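/- **Conventions.** Rings and monoids are commutative and unital. A *sesquiad* is a monoid $A$ with zero together with an addition, i.e. for each $k\in\mathbb Z^m$, $m\ge 2$, a partial operation $\Sigma_k$ defined on a subset $D_k\subset A^m$, such that for some injective multiplicative map $\varphi:A\hookrightarrow R$ into a ring, preserving $0$ and $1$, one has $D_k=\{a:\sum_j k_j\varphi(a_j)\in\varphi(A)\}$ and $\varphi(\Sigma_k(a))=\sum_jk_j\varphi(a_j)$. Morphisms are monoid maps preserving $0$, $1$ and all defined sums. Every ring is a sesquiad, and every submonoid $A\ni 0$ of a ring $R$ is a sesquiad with the addition of $R$ (a *subsesquiad* of $R$). The *universal ring* is $R_A=\mathbb Z[A]/(\sum_j k_ja_j-\Sigma_k(a) : a\in D_k)$. Let $\mathbb F_1=\{0,1\}\subset\mathbb Z$, the initial sesquiad. A *prime congruence* on $A$ is an equivalence relation $E$ such that $A/E$ carries a sesquiad structure making $A\to A/E$ a morphism, $1\not\sim_E0$, and $af\sim_E bf$ implies $a\sim_E b$ or $f\sim_E0$. The space $\operatorname{spec}_cA$ of prime congruences has the topology generated by the sets $D(a,b)=\{E: a\not\sim_E b\}$. For $E\in\operatorname{spec}_cA$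 let $S_E\subset R_A$ be the submonoid generated by all $a-b$ with $a,b\in A$, $0\not\sim_E a\not\sim_E b\not\sim_E 1$. The structure sheaf $\mathcal O$ of $\operatorname{spec}_cA$ has as sections over $U$ the families $(s(E))_{E\in U}$, $s(E)\in S_E^{-1}R_A$, which locally have the form $s(F)=a/f$ with fixed $a\in A$ and $f\in\bigcap_F S_F$; $\mathcal O(U)$ is a sesquiad as a subset of $\prod_{E\in U}S_E^{-1}R_A$. Morphisms between such spaces are continuous maps with a morphism of sheaves of sesquiads such that only units are mapped to units in the stalks (local morphisms). For $G=\operatorname{spec}_cA$ and a sesquiad $B$ put $G(B)=\operatorname{Hom}(\operatorname{spec}_cB,\operatorname{spec}_cA)$. **Groups.** Let $n\ge0$. * $\mathrm{GL}_n$, with coordinate ring $R=\mathbb Z[X_{i,j},Y]/(\det(X)Y-1)$ and $T$ the torus of diagonal matrices. * $\mathrm{Sp}_{2n}$, the group of all $g$ with $gJg^t=J$, $J=\begin{pmatrix}0&-I\\ I&0\end{pmatrix}$, with $R=\mathbb Z[X_{i,j}]/(XJX^t-J)$ and $T$ the torus of all $\operatorname{diag}(t_1,\dots,t_n,t_1^{-1},\dots,t_n^{-1})$.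 * The split $\mathrm O_n$, the group of all $g$ with $gQg^t=Q$, where $Q$ is block diagonal with $\lfloor n/2\rfloor$ blocks $\begin{pmatrix}0&1\\1&0\end{pmatrix}$ and, if $n$ is odd, a final entry $1$; here $R=\mathbb Z[X_{i,j}]/(XQX^t-Q)$, and $T$ is the torus of block diagonal matrices with blocks $\operatorname{diag}(t_m,t_m^{-1})$ and, if $n$ is odd, a final entry $1$. For a group scheme $H$ of matrices containing $T$ let $N_H(T)$ be the scheme-theoretic normalizer. The Weyl group of $\mathrm{GL}_n$, $\mathrm{Sp}_{2n}$ is $W=N(T)(\mathbb Z)/T(\mathbb Z)$ with $N=N_{\mathrm{GL}_n}$, $N_{\mathrm{Sp}_{2n}}$, respectively. For $\mathrm O_n$ the Weyl group is that of $\mathrm{SO}_n=\{g\in\mathrm O_n:\det g=1\}$, so $W=N(T)(\mathbb Z)/T(\mathbb Z)$ with $N=N_{\mathrm{SO}_n}$. **Theorem.** Let $\mathcal G$ be one of the groups $\mathrm{GL}_n$, $\mathrm{Sp}_{2n}$ or split $\mathrm O_n$, with coordinate ring $R$. There is a subsesquiad $A\subset R$ such that 1. $R_A=R$, i.e. the canonical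 map $R_A\to R$ is an isomorphism (so $G=\operatorname{spec}_cA$ is a model of $\mathcal G$); 2. the natural map $\operatorname{Hom}(A,\mathbb F_1)\to G(\mathbb F_1)=\operatorname{Hom}(\operatorname{spec}_c\mathbb F_1,\operatorname{spec}_cA)$ is a bijection; 3. the image of $G(\mathbb F_1)\to G(\mathbb Z)=\operatorname{Hom}(R,\mathbb Z)=\mathcal G(\mathbb Z)$ (composition with $\operatorname{spec}_c\mathbb Z\to\operatorname{spec}_c\mathbb F_1$) lies in $N(T)(\mathbb Z)$, and the resulting map $G(\mathbb F_1)\to N(T)(\mathbb Z)/T(\mathbb Z)=W$ is a bijection. For $\mathrm{GL}_n$, $A$ can be chosen such that moreover the image of $G(\mathbb F_1)$ is exactly the set of permutation matrices. For $\mathrm O_n$ with $n$ even there is also such an $A$ for which (1), (2), (3) hold with $N=N_{\mathrm O_n}$, the normalizer in the full orthogonal group. -/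

import Mathlib

universe u

noncomputable section

open TopologicalSpace

/-! ### Sesquiads -/

/-- A commutative monoid with zero `A` together with an addition. `IsSum k a b` says that the
tuple `a` lies in the domain `D_k` of the partial operation `Σ_k` and that `Σ_k(a) = b`, where `k`
is a tuple of integers of length at least two. An addition is required to come from an injective
multiplicative map `φ` (preserving zero and one) into a commutative ring, with `D_k` the set of
all `a` such that `∑ k_j φ(a_j)` lies in the image of `φ`. -/
structure Sesquiad : Type (u + 1) where
  carrier : Type u
  [monoid : CommMonoidWithZero carrier]
  IsSum : ∀ {n : ℕ}, (Fin (n + 2) → ℤ) → (Fin (n + 2) → carrier) → carrier → Prop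
  exists_rep : ∃ (R : Type u) (_ : CommRing R) (φ : carrier →*₀ R), Function.Injective φ ∧
    ∀ (n : ℕ) (k : Fin (n + 2) → ℤ) (a : Fin (n + 2) → carrier) (b : carrier),
      IsSum k a b ↔ ∑ j, k j • φ (a j) = φ b

namespace Sesquiad

instance : CoeSort Sesquiad.{u} (Type u) := ⟨carrier⟩

attribute [instance] Sesquiad.monoid

/-- Morphisms of sesquiads. -/
@[ext]
structure Hom (A B : Sesquiad.{u}) where
  toMonoidHom : A →*₀ B
  map_isSum : ∀ (n : ℕ) (k : Fin (n + 2) → ℤ) (a : Fin (n + 2) → A) (b : A),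
    A.IsSum k a b → B.IsSum k (fun j => toMonoidHom (a j)) (toMonoidHom b)

instance (A B : Sesquiad.{u}) : CoeFun (Hom A B) (fun _ => A → B) := ⟨fun φ => φ.toMonoidHom⟩

/-- The composition `ψ ∘ φ`. -/
def Hom.comp {A B C : Sesquiad.{u}} (ψ : Hom B C) (φ : Hom A B) : Hom A C where
  toMonoidHom := ψ.toMonoidHom.comp φ.toMonoidHom
  map_isSum n k a b h := ψ.map_isSum n k _ _ (φ.map_isSum n k a b h)

/-- A multiplicative submonoid containing zero, as a monoid with zero. -/
abbrev submonoidWithZero {R : Type u} [CommRing R] (A : Submonoid R) (h0 : (0 : R) ∈ A) :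
    CommMonoidWithZero A :=
  { (inferInstance : CommMonoid A) with
    zero := ⟨0, h0⟩
    zero_mul := fun a => Subtype.ext (zero_mul (a : R))
    mul_zero := fun a => Subtype.ext (mul_zero (a : R)) }

/-- A submonoid `A ∋ 0` of a ring `R` as a sesquiad, with the addition induced from `R`. -/
def ofSubmonoid {R : Type u} [CommRing R] (A : Submonoid R) (h0 : (0 : R) ∈ A) :
    Sesquiad.{u} where
  carrier := A
  monoid := submonoidWithZero A h0
  IsSum k a b := ∑ j, k j • (a j : R) = (b : R)
  exists_rep := by
    let _ := submonoidWithZero A h0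
    exact ⟨R, inferInstance,
      { toFun := fun a => (a : R), map_zero' := rfl, map_one' := rfl, map_mul' := fun _ _ => rfl },
      Subtype.val_injective, fun _ _ _ _ => Iff.rfl⟩

/-- A ring as a sesquiad. -/
def ofRing (R : Type u) [CommRing R] : Sesquiad.{u} where
  carrier := R
  IsSum k a b := ∑ j, k j • a j = b
  exists_rep := ⟨R, inferInstance, MonoidWithZeroHom.id R, Function.injective_id,
    fun _ _ _ _ => Iff.rfl⟩

/-- The inclusion of a subsesquiad of a ring. -/
def incl {R : Type u} [CommRing R] (A : Submonoid R) (h0 : (0 : R) ∈ A) :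
    Hom (ofSubmonoid A h0) (ofRing R) where
  toMonoidHom :=
    { toFun := fun a => (show A from a).1
      map_zero' := rfl
      map_one' := rfl
      map_mul' := fun _ _ => rfl }
  map_isSum _ _ _ _ h := h

/-- A ring homomorphism as a morphism of sesquiads. -/
def ofRingHom {R S : Type u} [CommRing R] [CommRing S] (f : R →+* S) :
    Hom (ofRing R) (ofRing S) where
  toMonoidHom :=
    { toFun := fun x => f x
      map_zero' := map_zero f
      map_one' := map_one f
      map_mul' := map_mul f }
  map_isSum n k a b h := by
    let a' : Fin (n + 2) → R := a
    have h' : ∑ j, k j • a' j = (show R from b) := h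
    change ∑ j, k j • f (a' j) = f b
    rw [← h', map_sum]
    exact Finset.sum_congr rfl fun j _ => (map_zsmul f (k j) (a' j)).symm

/-! ### The universal ring -/

/-- The ideal of the monoid ring `ℤ[A]` generated by all `∑ k_j a_j - Σ_k(a)`. -/
def relIdeal (A : Sesquiad.{u}) : Ideal (MonoidAlgebra ℤ A) :=
  Ideal.span {x | ∃ (n : ℕ) (k : Fin (n + 2) → ℤ) (a : Fin (n + 2) → A) (b : A),
    A.IsSum k a b ∧
      x = ∑ j, k j • MonoidAlgebra.of ℤ A (a j) - MonoidAlgebra.of ℤ A b}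

/-- The universal ring `R_A` of the sesquiad `A`. -/
def UnivRing (A : Sesquiad.{u}) : Type u := MonoidAlgebra ℤ A ⧸ A.relIdeal

instance (A : Sesquiad.{u}) : CommRing A.UnivRing :=
  inferInstanceAs (CommRing (MonoidAlgebra ℤ A ⧸ A.relIdeal))

/-- The canonical map `A → R_A`. -/
def toUniv (A : Sesquiad.{u}) : A →* A.UnivRing where
  toFun a := Ideal.Quotient.mk A.relIdeal (MonoidAlgebra.of ℤ A a)
  map_one' := by rw [map_one, map_one]; rfl
  map_mul' a b := by rw [map_mul, map_mul]; rfl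

theorem toUniv_isSum (A : Sesquiad.{u}) {n : ℕ} (k : Fin (n + 2) → ℤ) (a : Fin (n + 2) → A)
    (b : A) (h : A.IsSum k a b) : ∑ j, k j • A.toUniv (a j) = A.toUniv b := by
  have hm : (∑ j, k j • MonoidAlgebra.of ℤ A (a j) - MonoidAlgebra.of ℤ A b) ∈ A.relIdeal :=
    Ideal.subset_span ⟨n, k, a, b, h, rfl⟩
  have h2 := Ideal.Quotient.eq_zero_iff_mem.mpr hm
  rw [map_sub, map_sum, sub_eq_zero] at h2
  refine Eq.trans ?_ h2
  exact Finset.sum_congr rfl fun j _ =>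
    (map_zsmul (Ideal.Quotient.mk A.relIdeal) (k j) (MonoidAlgebra.of ℤ A (a j))).symm

/-- Zero is the empty sum, so it is sent to zero in the universal ring. -/
theorem isSum_zero (A : Sesquiad.{u}) : A.IsSum (n := 0) 0 0 0 := by
  obtain ⟨R, _, φ, _, h⟩ := A.exists_rep
  rw [h]
  simp

theorem toUniv_zero (A : Sesquiad.{u}) : A.toUniv 0 = 0 := by
  rw [← A.toUniv_isSum _ _ _ A.isSum_zero]
  simp

/-- The multiplicative map underlying a morphism from a sesquiad to a ring. -/
def Hom.toRingMonoidHom {A : Sesquiad.{u}} {S : Type u} [CommRing S] (φ : Hom A (ofRing S)) :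
    A →* S where
  toFun := φ
  map_one' := map_one φ.toMonoidHom
  map_mul' := map_mul φ.toMonoidHom

/-- The ring homomorphism `R_A → S` induced by a morphism from `A` to a ring `S`. -/
def univLift {A : Sesquiad.{u}} {S : Type u} [CommRing S] (φ : Hom A (ofRing S)) :
    A.UnivRing →+* S :=
  Ideal.Quotient.lift A.relIdeal
    ((MonoidAlgebra.lift ℤ S A φ.toRingMonoidHom : MonoidAlgebra ℤ A →ₐ[ℤ] S) :
      MonoidAlgebra ℤ A →+* S) (by
      intro x hx
      have hle : A.relIdeal ≤ RingHom.ker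
          ((MonoidAlgebra.lift ℤ S A φ.toRingMonoidHom : MonoidAlgebra ℤ A →ₐ[ℤ] S) :
            MonoidAlgebra ℤ A →+* S) := by
        refine Ideal.span_le.mpr ?_
        rintro x ⟨n, k, a, b, h, rfl⟩
        have h' : ∑ j, k j • φ.toRingMonoidHom (a j) = φ.toRingMonoidHom b :=
          φ.map_isSum n k a b h
        rw [SetLike.mem_coe, RingHom.mem_ker, RingHom.coe_coe, map_sub, map_sum,
          MonoidAlgebra.lift_of, ← h', sub_eq_zero]
        refine Finset.sum_congr rfl fun j _ => ?_
        rw [map_zsmul, MonoidAlgebra.lift_of]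
      exact hle hx)

theorem univLift_toUniv {A : Sesquiad.{u}} {S : Type u} [CommRing S] (φ : Hom A (ofRing S))
    (a : A) : univLift φ (A.toUniv a) = φ a :=
  MonoidAlgebra.lift_of φ.toRingMonoidHom a

/-- The canonical morphism from a sesquiad to its universal ring. -/
def toUnivHom (A : Sesquiad.{u}) : Hom A (ofRing A.UnivRing) where
  toMonoidHom := { A.toUniv with map_zero' := A.toUniv_zero }
  map_isSum _ k a b h := A.toUniv_isSum k a b h

/-- The ring homomorphism `R_A → R_B` induced by a morphism `A → B`. -/
def univMap {A B : Sesquiad.{u}} (φ : Hom A B) : A.UnivRing →+* B.UnivRing :=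
  univLift (B.toUnivHom.comp φ)

theorem univMap_toUniv {A B : Sesquiad.{u}} (φ : Hom A B) (a : A) :
    univMap φ (A.toUniv a) = B.toUniv (φ a) :=
  univLift_toUniv _ _

/-! ### The spectrum of prime congruences -/

/-- An equivalence relation on `A` is a congruence if `A/C` carries a sesquiad structure for
which the projection is a morphism of sesquiads, i.e. if it is the relation `φ a = φ b` for some
surjective morphism `φ : A → B`. -/
def IsCongruence (A : Sesquiad.{u}) (C : Setoid A) : Prop :=
  ∃ (B : Sesquiad.{u}) (φ : Hom A B), Function.Surjective φ ∧ ∀ a b, C a b ↔ φ a = φ b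

/-- A prime congruence: a congruence `C` whose quotient `A/C` is integral. -/
structure PrimeCongruence (A : Sesquiad.{u}) where
  rel : Setoid A
  isCongruence : A.IsCongruence rel
  not_one_zero : ¬ rel 1 0
  prime : ∀ a b f : A, rel (a * f) (b * f) → rel a b ∨ rel f 0

variable {A B C : Sesquiad.{u}}

/-- The topology on `spec_c A` generated by the sets `D(a,b)` of all `E` with `(a,b) ∉ E`. -/
instance : TopologicalSpace (PrimeCongruence A) :=
  TopologicalSpace.generateFrom {U | ∃ a b : A, U = {E | ¬ E.rel a b}}

/-- The submonoid `S_E` of `R_A`, generated by all `a - b` with `0 ≁ a`, `a ≁ b`, `b ≁ 1`. -/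
def locSubmonoid (E : PrimeCongruence A) : Submonoid A.UnivRing :=
  Submonoid.closure {x | ∃ a b : A, ¬ E.rel 0 a ∧ ¬ E.rel a b ∧ ¬ E.rel b 1 ∧
    x = A.toUniv a - A.toUniv b}

/-- The ring `S_E⁻¹ R_A`. The localization of `A` at `E` is its subset of all `a / f` with
`a ∈ A` and `f ∈ S_E`. -/
abbrev StalkRing (E : PrimeCongruence A) : Type u := Localization (locSubmonoid E)

/-- The condition for `s` to be a section of the structure sheaf over `U`: locally `s` is of the
form `F ↦ a / f` with `a ∈ A` and `f` in the intersection of all `S_F`. In particular `s E` lies in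
the localization of `A` at `E`. -/
def IsSection (U : Opens (PrimeCongruence A)) (s : ∀ E : U, StalkRing E.1) : Prop :=
  ∀ E : U, ∃ (V : Opens (PrimeCongruence A)) (hVU : V ≤ U), E.1 ∈ V ∧
    ∃ (a : A) (f : A.UnivRing), ∀ (F : PrimeCongruence A) (hF : F ∈ V),
      ∃ hf : f ∈ locSubmonoid F, s ⟨F, hVU hF⟩ = Localization.mk (A.toUniv a) ⟨f, hf⟩

/-- The sections over `U` as a submonoid of the product of the rings `S_E⁻¹ R_A`. -/
def sectionsSubmonoid (U : Opens (PrimeCongruence A)) :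
    Submonoid (∀ E : U, StalkRing E.1) where
  carrier := {s | IsSection U s}
  one_mem' := fun E => ⟨U, le_rfl, E.2, 1, 1, fun F _ => ⟨one_mem _, by
    rw [map_one]; exact (Localization.mk_one).symm⟩⟩
  mul_mem' := by
    rintro s t hs ht E
    obtain ⟨V, hV, hEV, a, f, h⟩ := hs E
    obtain ⟨W, hW, hEW, b, g, h'⟩ := ht E
    refine ⟨V ⊓ W, inf_le_left.trans hV, ⟨hEV, hEW⟩, a * b, f * g, fun F hF => ?_⟩
    obtain ⟨hf, e⟩ := h F hF.1
    obtain ⟨hg, e'⟩ := h' F hF.2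
    refine ⟨mul_mem hf hg, ?_⟩
    change s ⟨F, _⟩ * t ⟨F, _⟩ = _
    rw [e, e', Localization.mk_mul, map_mul]
    rfl

theorem zero_mem_sections (U : Opens (PrimeCongruence A)) :
    (0 : ∀ E : U, StalkRing E.1) ∈ sectionsSubmonoid U := fun E =>
  ⟨U, le_rfl, E.2, 0, 1, fun F _ => ⟨one_mem _, by
    rw [A.toUniv_zero]; exact (Localization.mk_zero _).symm⟩⟩

/-- The sesquiad `O(U)` of sections over `U`. -/
def sections (U : Opens (PrimeCongruence A)) : Sesquiad.{u} :=
  ofSubmonoid (sectionsSubmonoid U) (zero_mem_sections U)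

theorem IsSection.restrict {U V : Opens (PrimeCongruence A)} (h : U ≤ V)
    {s : ∀ E : V, StalkRing E.1} (hs : IsSection V s) :
    IsSection U (fun E => s ⟨E.1, h E.2⟩) := by
  intro E
  obtain ⟨W, hW, hE, a, f, H⟩ := hs ⟨E.1, h E.2⟩
  refine ⟨W ⊓ U, inf_le_right, ⟨hE, E.2⟩, a, f, fun F hF => ?_⟩
  exact H F hF.1

/-- Restriction of sections. -/
def resSections {U V : Opens (PrimeCongruence A)} (h : U ≤ V) :
    Hom (sections V) (sections U) where
  toMonoidHom :=
    { toFun := fun s => ⟨fun E => s.1 ⟨E.1, h E.2⟩, IsSection.restrict h s.2⟩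
      map_zero' := rfl
      map_one' := rfl
      map_mul' := fun _ _ => rfl }
  map_isSum n k a b H := by
    have H' : ∑ j, k j • (a j).1 = b.1 := H
    change ∑ j, k j • (fun E : U => (a j).1 ⟨E.1, h E.2⟩) = fun E : U => b.1 ⟨E.1, h E.2⟩
    rw [← H']
    funext E
    simp

end Sesquiad

/-! ### Sesquiaded spaces -/

/-- A topological space with a sheaf of sesquiads; the sheaf conditions say that `O` sends unions
of open sets to limits of sesquiads. -/
structure SesquiadedSpace : Type (u + 1) where
  carrier : Type u
  [top : TopologicalSpace carrier]
  sections : Opens carrier → Sesquiad.{u}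
  res : ∀ {U V : Opens carrier}, U ≤ V → Sesquiad.Hom (sections V) (sections U)
  res_self : ∀ (U : Opens carrier) (s : sections U), res (le_refl U) s = s
  res_res : ∀ {U V W : Opens carrier} (h : U ≤ V) (h' : V ≤ W) (s : sections W),
    res h (res h' s) = res (h.trans h') s
  eq_of_local : ∀ {ι : Type u} (U : ι → Opens carrier) (s t : sections (iSup U)),
    (∀ i, res (le_iSup U i) s = res (le_iSup U i) t) → s = t
  isSum_of_local : ∀ {ι : Type u} (U : ι → Opens carrier) (n : ℕ) (k : Fin (n + 2) → ℤ)
    (a : Fin (n + 2) → sections (iSup U)) (b : sections (iSup U)),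
    (∀ i, (sections (U i)).IsSum k (fun j => res (le_iSup U i) (a j)) (res (le_iSup U i) b)) →
      (sections (iSup U)).IsSum k a b
  glue : ∀ {ι : Type u} (U : ι → Opens carrier) (s : ∀ i, sections (U i)),
    (∀ i j, res (inf_le_left : U i ⊓ U j ≤ U i) (s i) =
      res (inf_le_right : U i ⊓ U j ≤ U j) (s j)) →
      ∃ t : sections (iSup U), ∀ i, res (le_iSup U i) t = s i

attribute [instance] SesquiadedSpace.top

namespace SesquiadedSpace

/-- Morphisms of sesquiaded spaces: a continuous map together with a morphism of sheaves. -/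
@[ext]
structure Mor (X Y : SesquiadedSpace.{u}) where
  base : C(X.carrier, Y.carrier)
  sharp : ∀ V : Opens Y.carrier, Sesquiad.Hom (Y.sections V) (X.sections (Opens.comap base V))
  sharp_res : ∀ {V W : Opens Y.carrier} (h : V ≤ W) (s : Y.sections W),
    sharp V (Y.res h s) = X.res (Opens.comap_mono base h) (sharp W s)

/-- The composition `g ∘ f`. -/
def Mor.comp {X Y Z : SesquiadedSpace.{u}} (g : Mor Y Z) (f : Mor X Y) : Mor X Z where
  base := g.base.comp f.base
  sharp V := (f.sharp (Opens.comap g.base V)).comp (g.sharp V)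
  sharp_res {V W} h s := by
    change f.sharp _ (g.sharp V (Z.res h s)) = X.res _ (f.sharp _ (g.sharp W s))
    rw [g.sharp_res h, f.sharp_res]

/-- The germ at `x` of a section `s` over `U ∋ x` is a unit of the stalk at `x`. -/
def IsUnitAt (X : SesquiadedSpace.{u}) (x : X.carrier) {U : Opens X.carrier}
    (s : X.sections U) : Prop :=
  ∃ (V : Opens X.carrier) (h : V ≤ U), x ∈ V ∧ ∃ t : X.sections V, X.res h s * t = 1

/-- A morphism is local if for every `x` the map on stalks `O_{Y,f(x)} → O_{X,x}` sends only units
to units. -/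
def Mor.IsLocal {X Y : SesquiadedSpace.{u}} (f : Mor X Y) : Prop :=
  ∀ (x : X.carrier) (V : Opens Y.carrier), f.base x ∈ V → ∀ s : Y.sections V,
    X.IsUnitAt x (f.sharp V s) → Y.IsUnitAt (f.base x) s

end SesquiadedSpace

namespace Sesquiad

variable {A B : Sesquiad.{u}}

/-- The congruence spectrum `spec_c A` as a sesquiaded space. -/
def specC (A : Sesquiad.{u}) : SesquiadedSpace.{u} where
  carrier := PrimeCongruence A
  sections U := sections U
  res h := resSections h
  res_self _ _ := rfl
  res_res _ _ _ := rfl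
  eq_of_local {ι} U s t h := by
    refine Subtype.ext (funext fun E => ?_)
    obtain ⟨i, hi⟩ := Opens.mem_iSup.mp E.2
    exact congrFun (congrArg Subtype.val (h i)) ⟨E.1, hi⟩
  isSum_of_local {ι} U n k a b h := by
    change ∑ j, k j • (a j).1 = b.1
    funext E
    obtain ⟨i, hi⟩ := Opens.mem_iSup.mp E.2
    have h1 : (∑ j, k j • fun F : U i => (a j).1 ⟨F.1, le_iSup U i F.2⟩) =
      fun F : U i => b.1 ⟨F.1, le_iSup U i F.2⟩ := h i
    have h2 := congrFun h1 ⟨E.1, hi⟩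
    simpa using h2
  glue {ι} U s h := by
    classical
    choose c hc using fun E : (iSup U : Opens (PrimeCongruence A)) => Opens.mem_iSup.mp E.2
    have key : ∀ (i : ι) (E : U i) (hE : E.1 ∈ iSup U),
        (s (c ⟨E.1, hE⟩)).1 ⟨E.1, hc ⟨E.1, hE⟩⟩ = (s i).1 E := fun i E hE =>
      congrFun (congrArg Subtype.val (h (c ⟨E.1, hE⟩) i)) ⟨E.1, hc ⟨E.1, hE⟩, E.2⟩
    refine ⟨⟨fun E => (s (c E)).1 ⟨E.1, hc E⟩, ?_⟩, ?_⟩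
    · intro E
      obtain ⟨V, hV, hE, a, f, H⟩ := (s (c E)).2 ⟨E.1, hc E⟩
      refine ⟨V, hV.trans (le_iSup U _), hE, a, f, fun F hF => ?_⟩
      obtain ⟨hf, e⟩ := H F hF
      exact ⟨hf, (key (c E) ⟨F, hV hF⟩ (le_iSup U _ (hV hF))).trans e⟩
    · intro i
      exact Subtype.ext (funext fun E => key i E (le_iSup U i E.2))

/-- The kernel of a morphism to a sesquiad is a congruence. -/
theorem isCongruence_of_ker {C : Setoid A} (φ : Hom A B) (h : ∀ a b, C a b ↔ φ a = φ b) :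
    A.IsCongruence C := by
  obtain ⟨R, _, ρ, hρ, hs⟩ := B.exists_rep
  let M : Submonoid R := MonoidHom.mrange ((ρ.comp φ.toMonoidHom : A →*₀ R) : A →* R)
  have h0 : (0 : R) ∈ M := ⟨0, map_zero (ρ.comp φ.toMonoidHom)⟩
  let π : A →*₀ ofSubmonoid M h0 :=
    { toFun := fun a => (⟨ρ (φ a), a, rfl⟩ : M)
      map_zero' := Subtype.ext (map_zero (ρ.comp φ.toMonoidHom))
      map_one' := Subtype.ext (map_one (ρ.comp φ.toMonoidHom))
      map_mul' := fun a b => Subtype.ext (map_mul (ρ.comp φ.toMonoidHom) a b) }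
  refine ⟨ofSubmonoid M h0,
    ⟨π, fun n k a b hab => (hs n k _ _).mp (φ.map_isSum n k a b hab)⟩, ?_, ?_⟩
  · rintro ⟨_, a, rfl⟩
    exact ⟨a, rfl⟩
  · intro a b
    rw [h]
    exact ⟨fun e => Subtype.ext (congrArg ρ e), fun e => hρ (congrArg Subtype.val e)⟩

/-- The map `φ^* : spec_c B → spec_c A`, sending `F` to the kernel of `A → B/F`. -/
def PrimeCongruence.pullback (φ : Hom A B) (F : PrimeCongruence B) : PrimeCongruence A where
  rel := Setoid.comap φ F.rel
  isCongruence := by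
    obtain ⟨Q, π, _, hπ⟩ := F.isCongruence
    exact isCongruence_of_ker (π.comp φ) fun a b => hπ (φ a) (φ b)
  not_one_zero h := F.not_one_zero (by
    have h' : F.rel (φ 1) (φ 0) := h
    rwa [map_one, map_zero] at h')
  prime a b f h := by
    have h' : F.rel (φ (a * f)) (φ (b * f)) := h
    rw [map_mul, map_mul] at h'
    refine (F.prime _ _ _ h').imp id fun h2 => ?_
    change F.rel (φ f) (φ 0)
    rwa [map_zero]

theorem continuous_pullback (φ : Hom A B) :
    Continuous (PrimeCongruence.pullback φ) := by
  refine continuous_generateFrom_iff.mpr ?_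
  rintro _ ⟨a, b, rfl⟩
  exact TopologicalSpace.isOpen_generateFrom_of_mem ⟨φ a, φ b, rfl⟩

theorem locSubmonoid_le_comap (φ : Hom A B) (F : PrimeCongruence B) :
    locSubmonoid (F.pullback φ) ≤ (locSubmonoid F).comap (univMap φ) := by
  refine Submonoid.closure_le.mpr ?_
  rintro _ ⟨a, b, h1, h2, h3, rfl⟩
  refine Submonoid.subset_closure ⟨φ a, φ b, ?_, h2, ?_, ?_⟩
  · intro h
    refine h1 ?_
    change F.rel (φ 0) (φ a)
    rwa [map_zero]
  · intro h
    refine h3 ?_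
    change F.rel (φ b) (φ 1)
    rwa [map_one]
  · rw [map_sub, univMap_toUniv, univMap_toUniv]

/-- The localized homomorphism `S_{φ^*F}⁻¹ R_A → S_F⁻¹ R_B`. -/
def stalkMap (φ : Hom A B) (F : PrimeCongruence B) :
    StalkRing (F.pullback φ) →+* StalkRing F :=
  IsLocalization.map (StalkRing F) (univMap φ) (locSubmonoid_le_comap φ F)

theorem stalkMap_mk (φ : Hom A B) (F : PrimeCongruence B) (a : A) (f : A.UnivRing)
    (hf : f ∈ locSubmonoid (F.pullback φ)) :
    stalkMap φ F (Localization.mk (A.toUniv a) ⟨f, hf⟩) =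
      Localization.mk (B.toUniv (φ a)) ⟨univMap φ f, locSubmonoid_le_comap φ F hf⟩ := by
  rw [Localization.mk_eq_mk'_apply, Localization.mk_eq_mk'_apply, stalkMap,
    IsLocalization.map_mk', univMap_toUniv]

/-- The continuous map `φ^* : spec_c B → spec_c A`. -/
def pullbackMap (φ : Hom A B) : C(PrimeCongruence B, PrimeCongruence A) :=
  ⟨PrimeCongruence.pullback φ, continuous_pullback φ⟩

/-- The map sending a family `s` on `V` to the family `F ↦ φ_F (s (φ^* F))`. -/
def pullbackFamily (φ : Hom A B) (V : Opens (PrimeCongruence A)) :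
    (∀ E : V, StalkRing E.1) →+*
      (∀ F : (Opens.comap (pullbackMap φ) V : Opens (PrimeCongruence B)), StalkRing F.1) :=
  RingHom.pi fun F => (stalkMap φ F.1).comp
    (Pi.evalRingHom (fun E : V => StalkRing E.1) ⟨F.1.pullback φ, F.2⟩)

theorem IsSection.pullback (φ : Hom A B) {V : Opens (PrimeCongruence A)}
    {s : ∀ E : V, StalkRing E.1} (hs : IsSection V s) :
    IsSection (Opens.comap (pullbackMap φ) V) (pullbackFamily φ V s) := by
  intro F
  obtain ⟨W, hW, hF, a, f, H⟩ := hs ⟨F.1.pullback φ, F.2⟩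
  refine ⟨Opens.comap (pullbackMap φ) W, fun G hG => hW hG, hF, φ a, univMap φ f,
    fun G hG => ?_⟩
  obtain ⟨hf, e⟩ := H (G.pullback φ) hG
  exact ⟨locSubmonoid_le_comap φ G hf,
    (congrArg (stalkMap φ G) e).trans (stalkMap_mk φ G a f hf)⟩

/-- The map on sections induced by `φ : A → B`. -/
def sharpMap (φ : Hom A B) (V : Opens (PrimeCongruence A)) :
    Hom (sections V) (sections (Opens.comap (pullbackMap φ) V)) where
  toMonoidHom :=
    { toFun := fun s => ⟨pullbackFamily φ V s.1, IsSection.pullback φ s.2⟩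
      map_zero' := Subtype.ext (map_zero (pullbackFamily φ V))
      map_one' := Subtype.ext (map_one (pullbackFamily φ V))
      map_mul' := fun s t => Subtype.ext (map_mul (pullbackFamily φ V) s.1 t.1) }
  map_isSum := by
    intro n k a b h
    have h1 : ∑ j, k j • (a j).1 = b.1 := h
    change ∑ j, k j • pullbackFamily φ V (a j).1 = pullbackFamily φ V b.1
    rw [← h1, map_sum]
    exact Finset.sum_congr rfl fun j _ => (map_zsmul (pullbackFamily φ V) (k j) (a j).1).symm

/-- The morphism of sesquiaded spaces `spec_c B → spec_c A` induced by `φ : A → B`. -/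
def specMap (φ : Hom A B) : SesquiadedSpace.Mor (specC B) (specC A) where
  base := pullbackMap φ
  sharp V := sharpMap φ V
  sharp_res _ _ := rfl

/-! ### The field with one element -/

/-- The sesquiad `𝔽₁`: the monoid `{0, 1}` with the trivial addition, which is the addition
induced from its reduced monoid ring `ℤ`. -/
def F1 : Sesquiad.{0} :=
  ofSubmonoid (R := ℤ)
    { carrier := {0, 1}
      one_mem' := Or.inr rfl
      mul_mem' := by
        rintro a b (rfl | rfl) hb
        · left; simp
        · simpa using hb }
    (Or.inl rfl)

/-- The unique morphism `𝔽₁ → ℤ`. -/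
def F1.toInt : Hom F1 (ofRing ℤ) := incl _ _

/-- `X(A) = Hom(spec_c A, X)`, the set of `A`-valued points of `X`. -/
def Points (X : SesquiadedSpace.{u}) (A : Sesquiad.{u}) : Type u :=
  {P : SesquiadedSpace.Mor (specC A) X // P.IsLocal}

end Sesquiad

/-! ### Tits models of matrix groups -/

section Tits

open Sesquiad

variable {ι κ : Type} [Fintype ι] [DecidableEq ι]

/-- Let `R` be the coordinate ring of a group scheme of matrices with universal matrix `X`, and let
`A` be a subsesquiad of `R`. `IsMatrixOf X A h0 P g` says that the image of
`P ∈ (spec_c A)(𝔽₁)` in `(spec_c A)(ℤ)` is the point given by a ring homomorphism `ψ : R → ℤ`,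
and that `g` is the integral matrix which corresponds to `ψ`. -/
def IsMatrixOf {R : Type} [CommRing R] (X : Matrix ι ι R) (A : Submonoid R) (h0 : (0 : R) ∈ A)
    (P : Points (specC (ofSubmonoid A h0)) F1) (g : Matrix ι ι ℤ) : Prop :=
  ∃ ψ : R →+* ℤ,
    P.1.comp (specMap F1.toInt) = specMap ((ofRingHom ψ).comp (incl A h0)) ∧ X.map ψ = g

/-- `N(T)(ℤ)`: the integral points of the scheme-theoretic normalizer, in a group scheme of
matrices with group of integral points `G`, of the subgroup scheme `T`. -/
def normalizerPts (G : Subgroup (GL ι ℤ))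
    (T : ∀ (S : Type) [CommRing S], Subgroup (GL ι S)) : Subgroup (GL ι ℤ) where
  carrier := {g | g ∈ G ∧ ∀ (S : Type) [CommRing S],
    Matrix.GeneralLinearGroup.map (Int.castRingHom S) g ∈
      Subgroup.normalizer (T S : Set (GL ι S))}
  one_mem' := ⟨one_mem _, fun S _ => by rw [map_one]; exact one_mem _⟩
  mul_mem' hg hh := ⟨mul_mem hg.1 hh.1, fun S _ => by
    rw [map_mul]; exact mul_mem (hg.2 S) (hh.2 S)⟩
  inv_mem' hg := ⟨inv_mem hg.1, fun S _ => by rw [map_inv]; exact inv_mem (hg.2 S)⟩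

/-- The subsesquiad `A` of the coordinate ring `R` (with universal matrix `X`) satisfies
`R_A = R`, and `spec_c A` is a Tits model with respect to the normalizer `N` of the torus `T`:
`Hom(A, 𝔽₁) → Hom(spec_c 𝔽₁, spec_c A)` is bijective, every `𝔽₁`-valued point is mapped into `N`,
and the resulting map to `N / T` is bijective. -/
def IsTitsModel {R : Type} [CommRing R] (X : Matrix ι ι R) (A : Submonoid R) (h0 : (0 : R) ∈ A)
    (N T : Subgroup (GL ι ℤ)) : Prop :=
  Function.Bijective (univLift (incl A h0)) ∧
  Set.BijOn (fun φ : Hom (ofSubmonoid A h0) F1 => specMap φ) Set.univ {P | P.IsLocal} ∧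
  ∃ w : Points (specC (ofSubmonoid A h0)) F1 → N,
    (∀ P, IsMatrixOf X A h0 P ((w P : GL ι ℤ) : Matrix ι ι ℤ)) ∧
    Function.Bijective fun P => (QuotientGroup.mk (w P) : N ⧸ T.subgroupOf N)

/-- The coordinate ring `ℤ[X_{i,j}, Y]/(det(X) Y - 1)` of the general linear group. -/
abbrev GLRing (ι : Type) [Fintype ι] [DecidableEq ι] : Type :=
  MvPolynomial ((ι × ι) ⊕ Unit) ℤ ⧸ Ideal.span
    {(Matrix.of fun i j => (MvPolynomial.X (Sum.inl (i, j)) :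
      MvPolynomial ((ι × ι) ⊕ Unit) ℤ)).det * MvPolynomial.X (Sum.inr ()) - 1}

/-- The universal invertible matrix. -/
def GLUniv (ι : Type) [Fintype ι] [DecidableEq ι] : Matrix ι ι (GLRing ι) :=
  Matrix.of fun i j => Ideal.Quotient.mk _ (MvPolynomial.X (Sum.inl (i, j)))

/-- The matrix `X J Xᵀ - J` over the polynomial ring `ℤ[X_{i,j}]`. -/
def formRel (J : Matrix ι ι ℤ) : Matrix ι ι (MvPolynomial (ι × ι) ℤ) :=
  Matrix.mvPolynomialX ι ι ℤ * J.map (Int.castRingHom (MvPolynomial (ι × ι) ℤ)) *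
    (Matrix.mvPolynomialX ι ι ℤ).transpose - J.map (Int.castRingHom (MvPolynomial (ι × ι) ℤ))

/-- The coordinate ring `ℤ[X_{i,j}]/(X J Xᵀ - J)` of the group of all `g` with `g J gᵀ = J`. -/
abbrev FormRing (J : Matrix ι ι ℤ) : Type :=
  MvPolynomial (ι × ι) ℤ ⧸ Ideal.span {f | ∃ i j, f = formRel J i j}

/-- The universal matrix with `X J Xᵀ = J`. -/
def FormUniv (J : Matrix ι ι ℤ) : Matrix ι ι (FormRing J) :=
  (Matrix.mvPolynomialX ι ι ℤ).map
    (Ideal.Quotient.mk (Ideal.span {f | ∃ i j, f = formRel J i j}))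

/-- The group of all integral matrices `g` with `g J gᵀ = J`. -/
def formGroup (J : Matrix ι ι ℤ) : Subgroup (GL ι ℤ) where
  carrier := {g | (g : Matrix ι ι ℤ) * J * (g : Matrix ι ι ℤ).transpose = J}
  one_mem' := by simp
  mul_mem' := by
    intro g h hg hh
    have hg' : (g : Matrix ι ι ℤ) * J * (g : Matrix ι ι ℤ).transpose = J := hg
    have hh' : (h : Matrix ι ι ℤ) * J * (h : Matrix ι ι ℤ).transpose = J := hh
    change ((g * h : GL ι ℤ) : Matrix ι ι ℤ) * J * ((g * h : GL ι ℤ) : Matrix ι ι ℤ).transpose = J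
    rw [Units.val_mul, Matrix.transpose_mul]
    calc (g : Matrix ι ι ℤ) * h * J * ((h : Matrix ι ι ℤ).transpose * (g : Matrix ι ι ℤ).transpose)
        = g * (h * J * (h : Matrix ι ι ℤ).transpose) * (g : Matrix ι ι ℤ).transpose := by
          simp only [Matrix.mul_assoc]
      _ = J := by rw [hh', hg']
  inv_mem' := by
    intro g hg
    have hg' : (g : Matrix ι ι ℤ) * J * (g : Matrix ι ι ℤ).transpose = J := hg
    have h1 : ((g⁻¹ : GL ι ℤ) : Matrix ι ι ℤ) * g = 1 := by
      rw [← Units.val_mul, inv_mul_cancel, Units.val_one]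
    have h2 : (g : Matrix ι ι ℤ).transpose * ((g⁻¹ : GL ι ℤ) : Matrix ι ι ℤ).transpose = 1 := by
      rw [← Matrix.transpose_mul, h1, Matrix.transpose_one]
    change ((g⁻¹ : GL ι ℤ) : Matrix ι ι ℤ) * J * ((g⁻¹ : GL ι ℤ) : Matrix ι ι ℤ).transpose = J
    calc ((g⁻¹ : GL ι ℤ) : Matrix ι ι ℤ) * J * ((g⁻¹ : GL ι ℤ) : Matrix ι ι ℤ).transpose
        = ((g⁻¹ : GL ι ℤ) : Matrix ι ι ℤ) * (g * J * (g : Matrix ι ι ℤ).transpose) *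
            ((g⁻¹ : GL ι ℤ) : Matrix ι ι ℤ).transpose := by rw [hg']
      _ = (((g⁻¹ : GL ι ℤ) : Matrix ι ι ℤ) * g) * J *
            ((g : Matrix ι ι ℤ).transpose * ((g⁻¹ : GL ι ℤ) : Matrix ι ι ℤ).transpose) := by
          simp only [Matrix.mul_assoc]
      _ = J := by rw [h1, h2, Matrix.one_mul, Matrix.mul_one]

/-- The matrices of determinant one. -/
def detOne (ι : Type) [Fintype ι] [DecidableEq ι] : Subgroup (GL ι ℤ) :=
  (Matrix.GeneralLinearGroup.det : GL ι ℤ →* ℤˣ).ker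

/-- The homomorphism sending a tuple of units to the corresponding diagonal matrix. -/
def diagHom (ι : Type) [Fintype ι] [DecidableEq ι] (S : Type) [CommRing S] :
    (ι → Sˣ) →* GL ι S where
  toFun t :=
    { val := Matrix.diagonal fun i => (t i : S)
      inv := Matrix.diagonal fun i => ((t i)⁻¹ : Sˣ)
      val_inv := by rw [Matrix.diagonal_mul_diagonal]; simp
      inv_val := by rw [Matrix.diagonal_mul_diagonal]; simp }
  map_one' := Units.ext (by simp)
  map_mul' s t := Units.ext (by simp [Matrix.diagonal_mul_diagonal])

/-- The diagonal maximal torus of `GL_n`. -/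
def torusGL (n : ℕ) (S : Type) [CommRing S] : Subgroup (GL (Fin n) S) :=
  (diagHom (Fin n) S).range

/-- The maximal torus of `Sp_{2n}`: the matrices `diag(t_1, …, t_n, t_1⁻¹, …, t_n⁻¹)`. -/
def torusSp (n : ℕ) (S : Type) [CommRing S] : Subgroup (GL (Fin n ⊕ Fin n) S) where
  carrier := {g | ∃ t : Fin n → Sˣ, g = diagHom _ S (Sum.elim t t⁻¹)}
  one_mem' := ⟨1, Eq.symm (by
    rw [inv_one, show (Sum.elim 1 1 : Fin n ⊕ Fin n → Sˣ) = 1 from Sum.elim_one_one, map_one])⟩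
  mul_mem' := by
    rintro _ _ ⟨s, rfl⟩ ⟨t, rfl⟩
    refine ⟨s * t, ?_⟩
    rw [← map_mul]
    congr 1
    ext (i | i) <;> simp [mul_comm]
  inv_mem' := by
    rintro _ ⟨s, rfl⟩
    refine ⟨s⁻¹, ?_⟩
    rw [← map_inv]
    congr 1
    ext (i | i) <;> simp

/-- The index set of the standard basis for the split orthogonal group `O_n`: there are `n / 2`
hyperbolic planes, and one further basis vector if `n` is odd. -/
abbrev OIdx (n : ℕ) : Type := (Fin 2 × Fin (n / 2)) ⊕ Fin (n % 2)

/-- The block diagonal matrix with `n / 2` blocks `(0 1; 1 0)` and, if `n` is odd, an entry `1` in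
the last corner. -/
def splitForm (n : ℕ) : Matrix (OIdx n) (OIdx n) ℤ :=
  Matrix.fromBlocks (Matrix.blockDiagonal fun _ : Fin (n / 2) => !![0, 1; 1, 0]) 0 0 1

/-- The maximal torus of `O_n`: the block diagonal matrices with blocks `diag(t_m, t_m⁻¹)` and, if
`n` is odd, an entry `1` in the last corner. -/
def torusO (n : ℕ) (S : Type) [CommRing S] : Subgroup (GL (OIdx n) S) where
  carrier := {g | ∃ t : Fin (n / 2) → Sˣ,
    g = diagHom _ S (Sum.elim (fun p => if p.1 = 0 then t p.2 else (t p.2)⁻¹) 1)}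
  one_mem' := ⟨1, Eq.symm (by
    rw [show (Sum.elim (fun p : Fin 2 × Fin (n / 2) =>
        if p.1 = 0 then (1 : Fin (n / 2) → Sˣ) p.2 else ((1 : Fin (n / 2) → Sˣ) p.2)⁻¹)
        (1 : Fin (n % 2) → Sˣ)) = 1 by ext (i | i) <;> simp, map_one])⟩
  mul_mem' := by
    rintro _ _ ⟨s, rfl⟩ ⟨t, rfl⟩
    refine ⟨s * t, ?_⟩
    rw [← map_mul]
    congr 1
    funext i
    rcases i with i | i
    · by_cases h : i.1 = 0 <;> simp [h, mul_comm]
    · simp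
  inv_mem' := by
    rintro _ ⟨s, rfl⟩
    refine ⟨s⁻¹, ?_⟩
    rw [← map_inv]
    congr 1
    funext i
    rcases i with i | i
    · by_cases h : i.1 = 0 <;> simp [h]
    · simp

end Tits

end

open TopologicalSpace

/-! ### Extensionality and functoriality of spectra -/

namespace Sesquiad

universe v

variable {A B C : Sesquiad.{v}}

/-! Choose representatives of the finite group `N/T`. Each is an integral point of the group, hence
a ring homomorphism `ψ w : R →+* ℤ`. The sesquiad `A` consists of all `r` in `R` whose value under
every `ψ w` is `0` or `1`. It is as large as possible subject to every `ψ w` restricting to a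
morphism `A → 𝔽₁`, and this size leaves no room for other morphisms.

The map `R_A → R` is injective for every subsesquiad, because each integral linear relation holding
in `R` is itself a defined sum (`univLift_incl_injective`). Surjectivity needs elements `e w` of `R`
with `ψ w (e w') = δ`: then `r - ∑ ψ w (r) e w` vanishes at all points and so lies in `A`, as do the
`e w`. A morphism `A → 𝔽₁` extends to `χ : R → ℤ`; if `r` vanishes at all points, both `r` and `2r`
lie in `A`, so `χ r` and `2 χ r` are in `{0, 1}` and `χ r = 0`. Hence `χ` factors through the
product of the points and is one of the `ψ w` (`exists_eq_zeroOneEval`).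

On the geometric side, a local morphism from the one-point space `spec_c 𝔽₁` is recovered from its
values on global sections (`specMap_pointHom`). Conversely, a morphism `A → 𝔽₁` induces a local map
because squares of differences of elements of `A` stay in `A` (`specMap_isLocal`).

The elements `e w` come from matrix entries. The torus contains a rational diagonal matrix with
distinct entries, so every element of `N(T)(ℤ)` is monomial with nonzero entries `±1`, and its class
modulo `T` is determined by its support. Products of factors `X i j ^ 2` and `1 - X i j ^ 2` detect
this support. -/

theorem PrimeCongruence.ext {E F : PrimeCongruence A} (h : E.rel = F.rel) : E = F := by
  cases E; cases F; cases h; rfl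

theorem Hom.ext_apply {φ ψ : Hom A B} (h : ∀ a, φ a = ψ a) : φ = ψ :=
  Hom.ext (MonoidWithZeroHom.ext h)

/-- Two morphisms into a spectrum agree if they have the same continuous map and the same values
of sections. -/
theorem Mor.ext_of_values {X : SesquiadedSpace.{v}} {P Q : SesquiadedSpace.Mor (specC B) X}
    (hb : P.base = Q.base)
    (hs : ∀ (V : Opens X.carrier) (s : X.sections V) (x : PrimeCongruence B)
      (hx : P.base x ∈ V) (hx' : Q.base x ∈ V),
      (P.sharp V s).1 ⟨x, hx⟩ = (Q.sharp V s).1 ⟨x, hx'⟩) : P = Q := by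
  obtain ⟨b, f, hf⟩ := P
  obtain ⟨b', g, hg⟩ := Q
  dsimp only at hb
  subst hb
  have : f = g := funext fun V => Hom.ext_apply fun s =>
    Subtype.ext (funext fun x => hs V s x.1 x.2 x.2)
  subst this
  rfl

theorem univRing_hom_ext {S : Type*} [Semiring S] {f g : A.UnivRing →+* S}
    (h : ∀ a, f (A.toUniv a) = g (A.toUniv a)) : f = g :=
  Ideal.Quotient.ringHom_ext (MonoidAlgebra.ringHom_ext' (RingHom.ext_int _ _)
    (MonoidHom.ext h))

theorem span_range_toUniv : Submodule.span ℤ (Set.range A.toUniv) = ⊤ := by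
  refine Submodule.eq_top_iff'.mpr fun x => ?_
  obtain ⟨p, rfl⟩ := Ideal.Quotient.mk_surjective (I := A.relIdeal) x
  induction p using MonoidAlgebra.induction_on with
  | of a => exact Submodule.subset_span ⟨a, rfl⟩
  | add p q hp hq => rw [map_add]; exact add_mem hp hq
  | smul k p hp => rw [map_zsmul]; exact Submodule.smul_mem _ k hp

theorem stalkMap_comp_apply (ψ : Hom B C) (φ : Hom A B) (F : PrimeCongruence C)
    (x : StalkRing (F.pullback (ψ.comp φ))) :
    stalkMap ψ F (stalkMap φ (F.pullback ψ) x) = stalkMap (ψ.comp φ) F x := by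
  have h : (univMap ψ).comp (univMap φ) = univMap (ψ.comp φ) := univRing_hom_ext fun a => by
    rw [RingHom.comp_apply, univMap_toUniv, univMap_toUniv, univMap_toUniv]
    rfl
  have h' : (stalkMap ψ F).comp (stalkMap φ (F.pullback ψ)) = stalkMap (ψ.comp φ) F := by
    refine IsLocalization.ringHom_ext (locSubmonoid ((F.pullback ψ).pullback φ))
      (RingHom.ext fun r => ?_)
    change stalkMap ψ F (stalkMap φ (F.pullback ψ) (algebraMap _ _ r)) =
      stalkMap (ψ.comp φ) F (algebraMap _ _ r)
    rw [stalkMap, stalkMap, stalkMap, IsLocalization.map_eq, IsLocalization.map_eq]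
    exact (congrArg _ (RingHom.congr_fun h r)).trans (IsLocalization.map_eq _ _).symm
  exact RingHom.congr_fun h' x

theorem specMap_comp (ψ : Hom B C) (φ : Hom A B) :
    (specMap φ).comp (specMap ψ) = specMap (ψ.comp φ) := by
  refine Mor.ext_of_values rfl fun V s x hx hx' => ?_
  exact stalkMap_comp_apply ψ φ x _

/-! ### Injectivity of the map from the universal ring -/

/-- An element of the universal ring is an integral combination of elements of the monoid. If its
image in the ring is zero, this says that the combination is a defined sum with value `0`, so it was
already zero. -/
theorem univLift_incl_injective {R : Type v} [CommRing R] (M : Submonoid R) (h0 : (0 : R) ∈ M) :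
    Function.Injective (univLift (incl M h0)) := by
  rw [injective_iff_map_eq_zero]
  intro x hx
  have hmem : x ∈ Submodule.span ℤ (Set.range (ofSubmonoid M h0).toUniv) :=
    span_range_toUniv ▸ Submodule.mem_top
  obtain ⟨c, rfl⟩ := Finsupp.mem_span_range_iff_exists_finsupp.mp hmem
  let e := c.support.equivFin
  -- Two terms with coefficient zero are prepended because defined sums have at least two terms.
  let k : Fin (c.support.card + 2) → ℤ := Fin.cons 0 (Fin.cons 0 fun j => c (e.symm j))
  let a : Fin (c.support.card + 2) → ofSubmonoid M h0 :=
    Fin.cons 0 (Fin.cons 0 fun j => (e.symm j).1)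
  have key : ∀ {S : Type v} [CommRing S] (f : ofSubmonoid M h0 → S),
      ∑ j, k j • f (a j) = c.sum fun i z => z • f i := by
    intro S _ f
    rw [Fin.sum_univ_succ, Fin.sum_univ_succ]
    simp only [k, a, Fin.cons_zero, Fin.cons_succ, zero_smul, zero_add]
    rw [Equiv.sum_comp e.symm (fun i : c.support => c i • f i), Finsupp.sum,
      Finset.sum_coe_sort c.support fun i => c i • f i]
  have hsum : (ofSubmonoid M h0).IsSum k a 0 := by
    refine (key (S := R) fun i => (i : M).1).trans ?_
    rw [map_finsuppSum] at hx
    simp only [map_zsmul, univLift_toUniv] at hx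
    exact hx
  rw [← key, toUniv_isSum _ _ _ _ hsum, toUniv_zero]

/-! ### Sections given by fractions -/

/-- The section `a / f` over an open set on which `f` is an admissible denominator. -/
noncomputable def fracSection (V : Opens (PrimeCongruence A)) (a : A) (f : A.UnivRing)
    (hf : ∀ F ∈ V, f ∈ locSubmonoid F) : sections V :=
  (⟨fun F => Localization.mk (A.toUniv a) ⟨f, hf F.1 F.2⟩,
    fun F => ⟨V, le_rfl, F.2, a, f, fun G hG => ⟨hf G hG, rfl⟩⟩⟩ : sectionsSubmonoid V)

theorem sections_ext {V : Opens (PrimeCongruence A)} {s t : sections V}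
    (h : ∀ (F : PrimeCongruence A) (hF : F ∈ V), s.1 ⟨F, hF⟩ = t.1 ⟨F, hF⟩) : s = t :=
  Subtype.ext (funext fun F => h F.1 F.2)

theorem mem_locSubmonoid_of_not_rel {E : PrimeCongruence A} {a : A} (h : ¬ E.rel a 0) :
    A.toUniv a ∈ locSubmonoid E :=
  Submonoid.subset_closure ⟨a, 0, fun h' => h (E.rel.symm' h'), h,
    fun h' => E.not_one_zero (E.rel.symm' h'), by rw [A.toUniv_zero, sub_zero]⟩

/-- The basic open set `D(a, b)`. -/
def basicOpen (a b : A) : Opens (PrimeCongruence A) :=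
  ⟨{E | ¬ E.rel a b}, isOpen_generateFrom_of_mem ⟨a, b, rfl⟩⟩

/-! ### The point of the spectrum of `𝔽₁` -/

theorem F1.eq_zero_or_one (a : F1) : a = 0 ∨ a = 1 := by
  obtain ⟨x, rfl | rfl⟩ := a
  exacts [Or.inl rfl, Or.inr rfl]

theorem F1.zero_ne_one : (0 : F1) ≠ 1 := fun h =>
  Int.zero_ne_one (congrArg F1.toInt h)

/-- The prime congruence with trivial classes on `𝔽₁`. -/
def F1.pt : PrimeCongruence F1 where
  rel := ⊥
  isCongruence := ⟨F1, ⟨MonoidWithZeroHom.id _, fun _ _ _ _ h => h⟩, Function.surjective_id,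
    fun _ _ => Iff.rfl⟩
  not_one_zero h := F1.zero_ne_one (Eq.symm h)
  prime a b f h := by
    rcases F1.eq_zero_or_one f with rfl | rfl
    · exact Or.inr rfl
    · left
      simpa using h

theorem F1.rel_iff (E : PrimeCongruence F1) (a b : F1) : E.rel a b ↔ a = b := by
  refine ⟨fun h => ?_, fun h => h ▸ E.rel.refl' a⟩
  rcases F1.eq_zero_or_one a with rfl | rfl <;> rcases F1.eq_zero_or_one b with rfl | rfl
  · rfl
  · exact absurd (E.rel.symm' h) E.not_one_zero
  · exact absurd h E.not_one_zero
  · rfl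

theorem F1.eq_pt (E : PrimeCongruence F1) : E = F1.pt :=
  PrimeCongruence.ext (Setoid.ext fun a b => by rw [F1.rel_iff, F1.rel_iff])

/-- The only admissible generator is `1 - 0`. Thus no proper denominators occur, and sections on
`spec_c 𝔽₁` take only the values `0` and `1`. -/
theorem F1.locSubmonoid_eq_bot (E : PrimeCongruence F1) : locSubmonoid E = ⊥ := by
  refine le_antisymm (Submonoid.closure_le.mpr ?_) bot_le
  rintro _ ⟨a, b, h1, h2, h3, rfl⟩
  rw [F1.rel_iff] at h1 h2 h3
  obtain rfl := (F1.eq_zero_or_one a).resolve_left (Ne.symm h1)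
  obtain rfl := (F1.eq_zero_or_one b).resolve_right h3
  rw [map_one, toUniv_zero, sub_zero]
  rfl

/-- The evaluation of germs on the spectrum of `𝔽₁` at the point given by `ℤ`. -/
noncomputable def F1.eval (E : PrimeCongruence F1) : StalkRing E →+* ℤ :=
  IsLocalization.lift (M := locSubmonoid E) (g := univLift F1.toInt) (by
    rintro ⟨y, hy⟩
    rw [F1.locSubmonoid_eq_bot, Submonoid.mem_bot] at hy
    subst hy
    exact (map_one (univLift F1.toInt)).symm ▸ isUnit_one)

/-- The integer `0` or `1` underlying an element of `𝔽₁`. -/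
def F1.val (a : F1) : ℤ := F1.toInt a

theorem F1.mk_eq {E : PrimeCongruence F1} (a : F1) (f : F1.UnivRing) (hf : f ∈ locSubmonoid E) :
    (Localization.mk (F1.toUniv a) ⟨f, hf⟩ : StalkRing E) = (F1.val a : StalkRing E) := by
  have h : f = 1 := by
    rwa [F1.locSubmonoid_eq_bot, Submonoid.mem_bot] at hf
  subst h
  rcases F1.eq_zero_or_one a with rfl | rfl
  · rw [toUniv_zero]
    exact (Localization.mk_zero _).trans Int.cast_zero.symm
  · rw [map_one]
    exact (Localization.mk_one).trans Int.cast_one.symm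

theorem F1.section_value {V : Opens (PrimeCongruence F1)} (s : sections V) (E : PrimeCongruence F1)
    (hE : E ∈ V) : s.1 ⟨E, hE⟩ = 0 ∨ s.1 ⟨E, hE⟩ = 1 := by
  obtain ⟨W, hW, hEW, a, f, h⟩ := s.2 ⟨E, hE⟩
  obtain ⟨hf, h⟩ := h E hEW
  rw [h, F1.mk_eq]
  rcases F1.eq_zero_or_one a with rfl | rfl
  · exact Or.inl Int.cast_zero
  · exact Or.inr Int.cast_one

end Sesquiad

noncomputable section

namespace Sesquiad

/-! ### Points over `𝔽₁` -/

variable {A : Sesquiad.{0}}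

/-- The value at the point of `spec_c 𝔽₁` of the pullback of a section. -/
def germ (P : SesquiadedSpace.Mor (specC F1) (specC A)) {V : Opens (PrimeCongruence A)}
    (h : P.base F1.pt ∈ V) (s : sections V) : StalkRing F1.pt :=
  (P.sharp V s).1 ⟨F1.pt, h⟩

section Germ

variable {P : SesquiadedSpace.Mor (specC F1) (specC A)} {V W : Opens (PrimeCongruence A)}
  (h : P.base F1.pt ∈ V)

theorem germ_one : germ P h 1 = 1 := by
  have e : P.sharp V (1 : sections V) = 1 := map_one (P.sharp V).toMonoidHom
  rw [germ]
  exact congrArg (fun t : sections (Opens.comap P.base V) => t.1 ⟨F1.pt, h⟩) e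

theorem germ_zero : germ P h 0 = 0 := by
  have e : P.sharp V (0 : sections V) = 0 := map_zero (P.sharp V).toMonoidHom
  rw [germ]
  exact congrArg (fun t : sections (Opens.comap P.base V) => t.1 ⟨F1.pt, h⟩) e

theorem germ_mul (s t : sections V) : germ P h (s * t) = germ P h s * germ P h t := by
  have e : P.sharp V (s * t) = P.sharp V s * P.sharp V t := map_mul (P.sharp V).toMonoidHom s t
  rw [germ]
  exact congrArg (fun t : sections (Opens.comap P.base V) => t.1 ⟨F1.pt, h⟩) e

theorem germ_isSum {n : ℕ} {k : Fin (n + 2) → ℤ} {a : Fin (n + 2) → sections V} {b : sections V}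
    (hs : (sections V).IsSum k a b) : ∑ j, k j • germ P h (a j) = germ P h b := by
  have e : ∑ j, k j • (P.sharp V (a j)).1 = (P.sharp V b).1 := (P.sharp V).map_isSum n k a b hs
  have e' := congrFun e ⟨F1.pt, h⟩
  rw [Finset.sum_apply] at e'
  exact e'

theorem germ_res (hWV : W ≤ V) (hW : P.base F1.pt ∈ W) (s : sections V) :
    germ P hW (resSections hWV s) = germ P h s := by
  have e := P.sharp_res hWV s
  exact congrArg (fun t : sections (Opens.comap P.base W) => t.1 ⟨F1.pt, hW⟩) e

theorem germ_eq_zero_or_one (s : sections V) : germ P h s = 0 ∨ germ P h s = 1 :=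
  F1.section_value _ _ _

end Germ

/-- The global section given by an element of `A`. -/
def globalSection (a : A) : sections (⊤ : Opens (PrimeCongruence A)) :=
  fracSection ⊤ a 1 fun _ _ => one_mem _

theorem globalSection_mul (a b : A) :
    globalSection (a * b) = globalSection a * globalSection b := by
  refine sections_ext fun F hF => ?_
  change Localization.mk _ _ = Localization.mk _ _ * Localization.mk _ _
  rw [Localization.mk_mul, map_mul]
  congr 1
  exact (mul_one _).symm

theorem globalSection_one : globalSection (1 : A) = 1 := by
  refine sections_ext fun F hF => ?_
  change Localization.mk _ _ = (1 : StalkRing F)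
  rw [map_one]
  exact Localization.mk_one

theorem globalSection_zero : globalSection (0 : A) = 0 := by
  refine sections_ext fun F hF => ?_
  change Localization.mk _ _ = (0 : StalkRing F)
  rw [toUniv_zero]
  exact Localization.mk_zero _

theorem globalSection_isSum {n : ℕ} {k : Fin (n + 2) → ℤ} {a : Fin (n + 2) → A} {b : A}
    (h : A.IsSum k a b) :
    (sections (⊤ : Opens (PrimeCongruence A))).IsSum k (fun j => globalSection (a j))
      (globalSection b) := by
  change ∑ j, k j • (globalSection (a j)).1 = (globalSection b).1
  have e : ∀ (a : A) (F : (⊤ : Opens (PrimeCongruence A))), (globalSection a).1 F =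
      algebraMap A.UnivRing (StalkRing F.1) (A.toUniv a) := fun a F =>
    Localization.mk_one_eq_algebraMap _
  funext F
  rw [Finset.sum_apply, e, ← toUniv_isSum A k a b h, map_sum]
  refine Finset.sum_congr rfl fun j _ => ?_
  rw [map_zsmul, ← e]
  rfl

theorem base_mem_top (P : SesquiadedSpace.Mor (specC F1) (specC A)) :
    P.base F1.pt ∈ (⊤ : Opens (PrimeCongruence A)) := trivial

variable (P : SesquiadedSpace.Mor (specC F1) (specC A))

theorem F1.intCast_injective (E : PrimeCongruence F1) :
    Function.Injective (Int.cast : ℤ → StalkRing E) := fun m n h => by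
  simpa using congrArg (F1.eval E) h

theorem F1.val_injective : Function.Injective F1.val := Subtype.val_injective

theorem F1.eval_germ_global (a : A) :
    F1.eval _ (germ P (V := ⊤) (base_mem_top P) (globalSection a)) = 0 ∨
      F1.eval _ (germ P (V := ⊤) (base_mem_top P) (globalSection a)) = 1 :=
  (germ_eq_zero_or_one (base_mem_top P) (globalSection a)).imp
    (fun h => by rw [h, map_zero]) (fun h => by rw [h, map_one])

/-- The morphism to `𝔽₁` defined by a point. -/
def pointHom : Hom A F1 where
  toMonoidHom :=
    { toFun := fun a => Subtype.mk (F1.eval _ (germ P (V := ⊤) (base_mem_top P) (globalSection a)))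
        (F1.eval_germ_global P a)
      map_zero' := Subtype.ext (by
        dsimp only
        rw [globalSection_zero, germ_zero, map_zero]
        rfl)
      map_one' := Subtype.ext (by
        dsimp only
        rw [globalSection_one, germ_one, map_one]
        rfl)
      map_mul' := fun a b => Subtype.ext (by
        dsimp only
        rw [globalSection_mul, germ_mul, map_mul]
        rfl) }
  map_isSum n k a b h := by
    change ∑ j, k j • F1.eval F1.pt (germ P (V := ⊤) (base_mem_top P) (globalSection (a j))) =
      F1.eval F1.pt (germ P (V := ⊤) (base_mem_top P) (globalSection b))
    rw [← germ_isSum (base_mem_top P) (globalSection_isSum h), map_sum]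
    exact Finset.sum_congr rfl fun j _ => (map_zsmul (F1.eval F1.pt) _ _).symm

theorem germ_global (a : A) :
    germ P (V := ⊤) (base_mem_top P) (globalSection a) = (F1.val (pointHom P a) : StalkRing F1.pt) := by
  change _ = ((F1.eval _ (germ P (V := ⊤) (base_mem_top P) (globalSection a)) : ℤ) : StalkRing F1.pt)
  rcases germ_eq_zero_or_one (base_mem_top P) (globalSection a) with h | h
  · rw [h, map_zero, Int.cast_zero]
  · rw [h, map_one, Int.cast_one]

theorem germ_frac {V : Opens (PrimeCongruence A)} (h : P.base F1.pt ∈ V) (a : A) (f : A.UnivRing)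
    (hf : ∀ F ∈ V, f ∈ locSubmonoid F) :
    germ P h (fracSection V a f hf) =
      F1.val (pointHom P a) * germ P h (fracSection V 1 f hf) := by
  have e : fracSection V a f hf =
      resSections le_top (globalSection a) * fracSection V 1 f hf := by
    refine sections_ext fun F hF => ?_
    change Localization.mk _ _ = Localization.mk _ _ * Localization.mk _ _
    rw [Localization.mk_mul, map_one, mul_one]
    congr 1
    exact (one_mul _).symm
  rw [e, germ_mul, germ_res (base_mem_top P), germ_global]

theorem fracSection_eq_one {V : Opens (PrimeCongruence A)} {a : A}
    (hf : ∀ F ∈ V, A.toUniv a ∈ locSubmonoid F) : fracSection V a (A.toUniv a) hf = 1 :=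
  sections_ext fun F hF => Localization.mk_self (⟨A.toUniv a, hf F hF⟩ : locSubmonoid F)

/-- Near the image point `a` is an admissible denominator, so its value is a factor of `1` and
cannot be `0`. Locality of the point is not needed here. -/
theorem pointHom_eq_one {a : A} (h : ¬ (P.base F1.pt).rel a 0) : pointHom P a = 1 := by
  have hm : P.base F1.pt ∈ basicOpen a 0 := h
  have hf : ∀ F ∈ basicOpen a 0, A.toUniv a ∈ locSubmonoid F := fun F hF =>
    mem_locSubmonoid_of_not_rel hF
  have e := germ_frac P hm a (A.toUniv a) hf
  rw [fracSection_eq_one, germ_one] at e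
  refine (F1.eq_zero_or_one _).resolve_left fun h0 => ?_
  rw [h0] at e
  have : (1 : StalkRing F1.pt) = (0 : ℤ) := e.trans (by
    rw [show F1.val 0 = 0 from rfl, Int.cast_zero, zero_mul])
  exact one_ne_zero (F1.intCast_injective F1.pt (Int.cast_one.trans this))

/-- The open set on which `a - b` is one of the generators of the monoid of denominators. -/
def subOpen (a b : A) : Opens (PrimeCongruence A) :=
  basicOpen 0 a ⊓ basicOpen a b ⊓ basicOpen b 1

theorem sub_mem_locSubmonoid {a b : A} {F : PrimeCongruence A} (hF : F ∈ subOpen a b) :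
    A.toUniv a - A.toUniv b ∈ locSubmonoid F :=
  Submonoid.subset_closure ⟨a, b, hF.1.1, hF.1.2, hF.2, rfl⟩

/-- The difference `a - b` need not belong to `A`, so multiplicativity alone gives nothing. Instead
the identity `a/(a-b) - b/(a-b) = 1` is a defined sum of sections, and morphisms of sheaves of
sesquiads preserve it. -/
theorem germ_sub {a b : A} (h : P.base F1.pt ∈ subOpen a b) :
    ((F1.val (pointHom P a) : StalkRing F1.pt) - F1.val (pointHom P b)) *
      germ P h (fracSection _ 1 (A.toUniv a - A.toUniv b) fun _ hF => sub_mem_locSubmonoid hF) =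
      1 := by
  have hs : (sections (subOpen a b)).IsSum (n := 0) ![1, -1]
      ![fracSection _ a (A.toUniv a - A.toUniv b) fun _ hF => sub_mem_locSubmonoid hF,
        fracSection _ b (A.toUniv a - A.toUniv b) fun _ hF => sub_mem_locSubmonoid hF] 1 := by
    have : ∀ F (hF : F ∈ subOpen a b),
        Localization.mk (A.toUniv a) (⟨_, sub_mem_locSubmonoid hF⟩ : locSubmonoid F) -
        Localization.mk (A.toUniv b) (⟨_, sub_mem_locSubmonoid hF⟩ : locSubmonoid F) = 1 := by
      intro F hF
      rw [sub_eq_iff_eq_add,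
        ← Localization.mk_self (⟨A.toUniv a - A.toUniv b, sub_mem_locSubmonoid hF⟩ :
          locSubmonoid F), Localization.add_mk_self]
      exact congrArg (fun r => Localization.mk r (⟨A.toUniv a - A.toUniv b,
        sub_mem_locSubmonoid hF⟩ : locSubmonoid F)) (sub_add_cancel _ _).symm
    change ∑ j, _ = _
    rw [Fin.sum_univ_two]
    funext F
    have key : ∀ x y : StalkRing F.1, (1 : ℤ) • x + (-1 : ℤ) • y = x - y := fun x y => by
      rw [one_smul, neg_smul, one_smul, sub_eq_add_neg]
    exact (key _ _).trans (this F.1 F.2)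
  have e := germ_isSum h hs
  rw [Fin.sum_univ_two, germ_one] at e
  simp only [Matrix.cons_val_zero, Matrix.cons_val_one, one_smul, neg_smul, ← sub_eq_add_neg] at e
  rw [germ_frac P h a, germ_frac P h b] at e
  rw [sub_mul, e]

theorem not_mem_subOpen_of_eq {a b : A} (h : pointHom P a = pointHom P b) :
    P.base F1.pt ∉ subOpen a b := fun hm => by
  have e := germ_sub P hm
  rw [h, sub_self, zero_mul] at e
  exact one_ne_zero (F1.intCast_injective F1.pt
    (Int.cast_one.trans (e.symm.trans Int.cast_zero.symm)))

/-- Both elements have value `1`. Were they inequivalent, one of their two differences would be an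
admissible denominator at the image point, with value `1 - 1 = 0`, contradicting `germ_sub`. -/
theorem rel_of_not_rel_zero {a b : A} (ha : ¬ (P.base F1.pt).rel a 0)
    (hb : ¬ (P.base F1.pt).rel b 0) : (P.base F1.pt).rel a b := by
  have hφ : pointHom P a = pointHom P b := by rw [pointHom_eq_one P ha, pointHom_eq_one P hb]
  by_contra hab
  -- The denominator `a - b` is admissible only if `b` is not equivalent to `1`; otherwise `b - a`
  -- is used, since `a` equivalent to `1` would force `a` equivalent to `b`.
  by_cases h1 : (P.base F1.pt).rel b 1
  · refine not_mem_subOpen_of_eq P hφ.symm ⟨⟨fun h => hb (Setoid.symm' _ h),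
      fun h => hab (Setoid.symm' _ h)⟩, fun h => hab ?_⟩
    exact Setoid.trans' _ h (Setoid.symm' _ h1)
  · exact not_mem_subOpen_of_eq P hφ ⟨⟨fun h => ha (Setoid.symm' _ h), hab⟩, h1⟩

/-- A congruence is the kernel of a map to a ring which is compatible with sums. -/
theorem exists_univ_hom (E : PrimeCongruence A) : ∃ (R : Type) (_ : CommRing R)
    (χ : A.UnivRing →+* R), ∀ a b, E.rel a b ↔ χ (A.toUniv a) = χ (A.toUniv b) := by
  obtain ⟨Q, π, -, hπ⟩ := E.isCongruence
  obtain ⟨R, _, ρ, hρ, hs⟩ := Q.exists_rep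
  let ρ' : Hom Q (ofRing R) := ⟨ρ, fun n k a b h => (hs n k a b).mp h⟩
  refine ⟨R, inferInstance, univLift (ρ'.comp π), fun a b => ?_⟩
  rw [univLift_toUniv, univLift_toUniv, hπ]
  exact hρ.eq_iff.symm

variable {P}

/-- If the value were `1`, locality would make `b` a unit in the stalk. But the quotient by the
congruence embeds in a ring to which the stalk maps, and there `b` becomes `0`. -/
theorem pointHom_eq_zero (hP : P.IsLocal) {b : A} (h : (P.base F1.pt).rel b 0) :
    pointHom P b = 0 := by
  refine (F1.eq_zero_or_one _).resolve_right fun h1 => ?_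
  have hu : (specC F1).IsUnitAt F1.pt (P.sharp ⊤ (globalSection b)) := by
    refine ⟨_, le_rfl, trivial, 1, ?_⟩
    rw [(specC F1).res_self, mul_one]
    refine sections_ext fun F hF => ?_
    obtain rfl := F1.eq_pt F
    refine (germ_global P b).trans ?_
    rw [h1]
    exact Int.cast_one
  obtain ⟨V, hV, hE, t, ht⟩ := hP F1.pt ⊤ trivial _ hu
  have e : algebraMap A.UnivRing (StalkRing (P.base F1.pt)) (A.toUniv b) * t.1 ⟨_, hE⟩ = 1 :=
    (congrArg (· * t.1 ⟨_, hE⟩) (Localization.mk_one_eq_algebraMap _).symm).trans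
      (congrArg (fun s : sections V => s.1 ⟨_, hE⟩) ht)
  obtain ⟨R, _, χ, hχ⟩ := exists_univ_hom (P.base F1.pt)
  -- At this point there are only the classes of `0` and `1`, so each generator of the denominators
  -- is of the form `x - y` with `x` equivalent to `1` and `y` to `0`. All denominators are
  -- therefore sent to `1`, and `χ` extends to the stalk.
  have hunit : locSubmonoid (P.base F1.pt) ≤ (⊥ : Submonoid R).comap χ := by
    refine Submonoid.closure_le.mpr ?_
    rintro _ ⟨x, y, h1, h2, h3, rfl⟩
    have hx : ¬ (P.base F1.pt).rel x 0 := fun h => h1 (Setoid.symm' _ h)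
    have hy : (P.base F1.pt).rel y 0 := by
      by_contra hy
      exact h2 (rel_of_not_rel_zero P hx hy)
    have hx1 := rel_of_not_rel_zero P hx (P.base F1.pt).not_one_zero
    change χ (A.toUniv x - A.toUniv y) = 1
    rw [map_sub, (hχ _ _).mp hx1, (hχ _ _).mp hy, toUniv_zero, map_one, map_one, map_zero,
      sub_zero]
  let g : StalkRing (P.base F1.pt) →+* R :=
    IsLocalization.lift (M := locSubmonoid (P.base F1.pt)) (g := χ) fun y => by
      rw [show χ y = 1 from hunit y.2]
      exact isUnit_one
  have e' := congrArg g e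
  rw [map_mul, IsLocalization.lift_eq, (hχ _ _).mp h, toUniv_zero, map_zero, zero_mul,
    map_one] at e'
  refine (P.base F1.pt).not_one_zero ((hχ 1 0).mpr ?_)
  rw [map_one, map_one, toUniv_zero, map_zero, e']

theorem rel_zero_iff (hP : P.IsLocal) (a : A) :
    (P.base F1.pt).rel a 0 ↔ pointHom P a = 0 := by
  refine ⟨pointHom_eq_zero hP, fun h => ?_⟩
  by_contra h'
  exact F1.zero_ne_one (h.symm.trans (pointHom_eq_one P h'))

theorem base_eq (hP : P.IsLocal) : P.base F1.pt = F1.pt.pullback (pointHom P) := by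
  refine PrimeCongruence.ext (Setoid.ext fun a b => ?_)
  change _ ↔ F1.pt.rel (pointHom P a) (pointHom P b)
  rw [F1.rel_iff]
  by_cases ha : (P.base F1.pt).rel a 0
  · rw [pointHom_eq_zero hP ha, eq_comm, ← rel_zero_iff hP]
    exact ⟨fun h => Setoid.trans' _ (Setoid.symm' _ h) ha,
      fun h => Setoid.trans' _ ha (Setoid.symm' _ h)⟩
  · by_cases hb : (P.base F1.pt).rel b 0
    · rw [pointHom_eq_zero hP hb, ← rel_zero_iff hP]
      exact ⟨fun h => Setoid.trans' _ h hb, fun h => Setoid.trans' _ h (Setoid.symm' _ hb)⟩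
    · rw [pointHom_eq_one P ha, pointHom_eq_one P hb]
      exact iff_of_true (rel_of_not_rel_zero P ha hb) rfl

/-- Denominators at the image of a local point have value one. -/
theorem exists_germ_den_eq_one (hP : P.IsLocal) {f : A.UnivRing}
    (hf : f ∈ locSubmonoid (P.base F1.pt)) :
    ∃ (V : Opens (PrimeCongruence A)) (h : P.base F1.pt ∈ V)
      (hf : ∀ F ∈ V, f ∈ locSubmonoid F), germ P h (fracSection V 1 f hf) = 1 := by
  induction hf using Submonoid.closure_induction with
  | mem f hf =>
    obtain ⟨a, b, h1, h2, h3, rfl⟩ := hf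
    refine ⟨subOpen a b, ⟨⟨h1, h2⟩, h3⟩, fun F hF => sub_mem_locSubmonoid hF, ?_⟩
    have ha : ¬ (P.base F1.pt).rel a 0 := fun h => h1 (Setoid.symm' _ h)
    have hb : (P.base F1.pt).rel b 0 := by
      by_contra hb
      exact h2 (rel_of_not_rel_zero P ha hb)
    have e := germ_sub P (a := a) (b := b) ⟨⟨h1, h2⟩, h3⟩
    rw [pointHom_eq_one P ha, pointHom_eq_zero hP hb, show F1.val 0 = 0 from rfl,
      show F1.val 1 = 1 from rfl, Int.cast_one, Int.cast_zero, sub_zero, one_mul] at e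
    exact e
  | one =>
    refine ⟨⊤, trivial, fun F _ => one_mem _, ?_⟩
    rw [← germ_one (P := P) (base_mem_top P), ← globalSection_one]
    rfl
  | mul f g _ _ hf hg =>
    obtain ⟨V, hV, hfV, e⟩ := hf
    obtain ⟨W, hW, hgW, e'⟩ := hg
    refine ⟨V ⊓ W, ⟨hV, hW⟩, fun F hF => mul_mem (hfV F hF.1) (hgW F hF.2), ?_⟩
    have hm : P.base F1.pt ∈ V ⊓ W := ⟨hV, hW⟩
    have h : fracSection (V ⊓ W) 1 (f * g) (fun F hF => mul_mem (hfV F hF.1) (hgW F hF.2)) =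
        resSections inf_le_left (fracSection V (1 : A) f hfV) *
          resSections inf_le_right (fracSection W (1 : A) g hgW) := by
      refine sections_ext fun F hF => ?_
      change Localization.mk _ _ = Localization.mk _ _ * Localization.mk _ _
      rw [Localization.mk_mul, ← map_mul, one_mul]
      rfl
    rw [h, germ_mul hm, germ_res hV, germ_res hW, e, e', one_mul]

/-- The value of a section at a local point is determined by the value of a numerator. -/
theorem germ_eq_of_local (hP : P.IsLocal) {V : Opens (PrimeCongruence A)}
    (h : P.base F1.pt ∈ V) (s : sections V) {W : Opens (PrimeCongruence A)} (hWV : W ≤ V)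
    (hW : P.base F1.pt ∈ W) {a : A} {f : A.UnivRing} (hf : ∀ F ∈ W, f ∈ locSubmonoid F)
    (hs : resSections hWV s = fracSection W a f hf) :
    germ P h s = (F1.val (pointHom P a) : StalkRing F1.pt) := by
  obtain ⟨U, hU, hfU, e⟩ := exists_germ_den_eq_one hP (hf _ hW)
  have hm : P.base F1.pt ∈ W ⊓ U := ⟨hW, hU⟩
  rw [← germ_res h hWV hW, hs, germ_frac, ← germ_res hW inf_le_left hm,
    show resSections inf_le_left (fracSection W 1 f hf) =
      resSections inf_le_right (fracSection U (1 : A) f hfU) from rfl, germ_res hU, e, mul_one]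

/-! ### Morphisms to `𝔽₁` versus local points -/

theorem stalkMap_F1_mk (φ : Hom A F1) (E : PrimeCongruence F1) (a : A) {f : A.UnivRing}
    (hf : f ∈ locSubmonoid (E.pullback φ)) :
    stalkMap φ E (Localization.mk (A.toUniv a) ⟨f, hf⟩) = (F1.val (φ a) : StalkRing E) :=
  (stalkMap_mk φ E a f hf).trans (F1.mk_eq _ _ _)

/-- The congruence at the image point is the kernel of `pointHom P`, and denominators there have
value `1`. Both morphisms thus send a local fraction `a/f` to the value of `a`. -/
theorem specMap_pointHom (hP : P.IsLocal) : specMap (pointHom P) = P := by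
  have hb : (specMap (pointHom P)).base = P.base := ContinuousMap.ext fun x => by
    obtain rfl := F1.eq_pt x
    exact (base_eq hP).symm
  refine Mor.ext_of_values hb fun V s x hx hx' => ?_
  obtain rfl := F1.eq_pt x
  obtain ⟨W, hWV, hW, a, f, H⟩ := s.2 ⟨P.base F1.pt, hx'⟩
  have hf : ∀ F ∈ W, f ∈ locSubmonoid F := fun F hF => (H F hF).1
  have hs : resSections hWV s = fracSection W a f hf := sections_ext fun F hF => (H F hF).2
  refine Eq.trans ?_ (germ_eq_of_local hP hx' s hWV hW hf hs).symm
  have hW' : F1.pt.pullback (pointHom P) ∈ W := base_eq hP ▸ hW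
  obtain ⟨hf', e⟩ := H _ hW'
  exact (congrArg (stalkMap (pointHom P) F1.pt) e).trans (stalkMap_F1_mk _ _ a hf')

theorem specMap_injective_of_base {B : Sesquiad.{0}} {φ ψ : Hom A B} (E : PrimeCongruence B)
    (h : specMap φ = specMap ψ) (a b : A) : E.rel (φ a) (φ b) ↔ E.rel (ψ a) (ψ b) := by
  have e : E.pullback φ = E.pullback ψ :=
    congrArg (fun P : SesquiadedSpace.Mor (specC B) (specC A) => P.base E) h
  change (E.pullback φ).rel a b ↔ (E.pullback ψ).rel a b
  rw [e]

theorem specMap_injective : Function.Injective fun φ : Hom A F1 => specMap φ := by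
  intro φ ψ h
  refine Hom.ext_apply fun a => ?_
  have e := specMap_injective_of_base F1.pt h a 0
  rw [F1.rel_iff, F1.rel_iff] at e
  have h0 : φ 0 = 0 := map_zero φ.toMonoidHom
  have h0' : ψ 0 = 0 := map_zero ψ.toMonoidHom
  rw [h0, h0'] at e
  rcases F1.eq_zero_or_one (φ a) with h1 | h1 <;> rcases F1.eq_zero_or_one (ψ a) with h2 | h2
  · rw [h1, h2]
  · exact absurd ((e.mp h1).symm.trans h2) F1.zero_ne_one
  · exact absurd ((e.mpr h2).symm.trans h1) F1.zero_ne_one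
  · rw [h1, h2]

/-- If `a/f` becomes a unit, then `a` is not equivalent to `0` and is an admissible denominator
nearby. The inverse `f/a` need not have its numerator in `A`, but it equals `f²/(fa)`, and the
hypothesis on squares puts `f²` in `A`. -/
theorem specMap_isLocal (hA : ∀ a b : A, ∃ c : A, (A.toUniv a - A.toUniv b) ^ 2 = A.toUniv c)
    (φ : Hom A F1) : (specMap φ).IsLocal := by
  intro x V hV s hu
  obtain ⟨U, hU, hx, t, ht⟩ := hu
  obtain ⟨W, hWV, hW, a, f, H⟩ := s.2 ⟨x.pullback φ, hV⟩
  have hf : ∀ F ∈ W, f ∈ locSubmonoid F := fun F hF => (H F hF).1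
  have hs : resSections hWV s = fracSection W a f hf := sections_ext fun F hF => (H F hF).2
  have ha : ¬ (x.pullback φ).rel a 0 := by
    intro h
    have h' : φ a = φ 0 := (F1.rel_iff x _ _).mp h
    obtain ⟨hf', e⟩ := H _ hW
    have e1 : (F1.val (φ a) : StalkRing x) * t.1 ⟨x, hx⟩ = 1 :=
      (congrArg (· * t.1 ⟨x, hx⟩) ((congrArg (stalkMap φ x) e).trans
        (stalkMap_F1_mk φ x a hf'))).symm.trans
        (congrArg (fun s : sections U => s.1 ⟨x, hx⟩) ht)
    rw [h', show F1.val (φ 0) = 0 from congrArg F1.val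
      (map_zero φ.toMonoidHom), Int.cast_zero, zero_mul] at e1
    exact zero_ne_one (F1.intCast_injective x (Int.cast_zero.trans (e1.trans Int.cast_one.symm)))
  have hsq : ∃ c : A, f ^ 2 = A.toUniv c := by
    have hfx : f ∈ locSubmonoid (x.pullback φ) := hf _ hW
    clear hf hs H
    induction hfx using Submonoid.closure_induction with
    | mem f hf =>
      obtain ⟨a, b, -, -, -, rfl⟩ := hf
      exact hA a b
    | one => exact ⟨1, by rw [map_one, one_pow]⟩
    | mul f g _ _ hf hg =>
      obtain ⟨c, hc⟩ := hf
      obtain ⟨d, hd⟩ := hg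
      exact ⟨c * d, by rw [mul_pow, hc, hd, map_mul]⟩
  obtain ⟨c, hc⟩ := hsq
  have hfa : ∀ F ∈ W ⊓ basicOpen a 0, f * A.toUniv a ∈ locSubmonoid F := fun F hF =>
    mul_mem (hf F hF.1) (mem_locSubmonoid_of_not_rel hF.2)
  refine ⟨W ⊓ basicOpen a 0, inf_le_left.trans hWV, ⟨hW, ha⟩, fracSection _ c _ hfa, ?_⟩
  refine sections_ext fun F hF => ?_
  obtain ⟨hf', e⟩ := H F hF.1
  change s.1 ⟨F, _⟩ * Localization.mk _ _ = 1
  rw [e, Localization.mk_mul, ← hc]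
  refine Eq.trans ?_ (Localization.mk_self (⟨f * (f * A.toUniv a),
    mul_mem hf' (hfa F hF)⟩ : locSubmonoid F))
  congr 1
  ring

end Sesquiad

end

namespace Sesquiad

noncomputable section

/-! ### Subsesquiads defined by finitely many integral points -/

variable {R W : Type} [CommRing R]

/-- The elements which take the values `0` and `1` only at the given integral points. -/
def zeroOneSubmonoid (ψ : W → R →+* ℤ) : Submonoid R where
  carrier := {r | ∀ w, ψ w r = 0 ∨ ψ w r = 1}
  one_mem' w := Or.inr (map_one (ψ w))
  mul_mem' {r s} hr hs w := by
    rw [map_mul]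
    rcases hr w with h | h
    · exact Or.inl (by rw [h, zero_mul])
    · rw [h, one_mul]
      exact hs w

variable {ψ : W → R →+* ℤ}

theorem zero_mem_zeroOneSubmonoid : (0 : R) ∈ zeroOneSubmonoid ψ :=
  fun w => Or.inl (map_zero (ψ w))

variable (ψ) in
/-- The sesquiad of all elements which take the values `0` and `1` only. -/
def zeroOne : Sesquiad.{0} := ofSubmonoid (zeroOneSubmonoid ψ) zero_mem_zeroOneSubmonoid

/-- The inclusion into the ring. -/
abbrev zeroOneIncl : Hom (zeroOne ψ) (ofRing R) :=
  incl (zeroOneSubmonoid ψ) zero_mem_zeroOneSubmonoid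

theorem univLift_zeroOneIncl (a : zeroOneSubmonoid ψ) :
    univLift zeroOneIncl ((zeroOne ψ).toUniv a) = a.1 :=
  univLift_toUniv _ _

/-- At each point a difference of two values has square `0` or `1`, so the squared difference lies
in the submonoid. Injectivity of the map from the universal ring transfers the identity back. -/
theorem zeroOne_sub_sq (a b : zeroOne ψ) :
    ∃ c : zeroOne ψ, ((zeroOne ψ).toUniv a - (zeroOne ψ).toUniv b) ^ 2 = (zeroOne ψ).toUniv c := by
  let x : zeroOneSubmonoid ψ := a
  let y : zeroOneSubmonoid ψ := b
  have hc : (x.1 - y.1) ^ 2 ∈ zeroOneSubmonoid ψ := fun w => by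
    rw [map_pow, map_sub]
    rcases x.2 w with h | h <;> rcases y.2 w with h' | h' <;> rw [h, h'] <;> norm_num
  refine ⟨(⟨_, hc⟩ : zeroOneSubmonoid ψ), univLift_incl_injective _ zero_mem_zeroOneSubmonoid ?_⟩
  change univLift zeroOneIncl _ = univLift zeroOneIncl _
  rw [map_pow, map_sub, univLift_zeroOneIncl x, univLift_zeroOneIncl y, univLift_zeroOneIncl]

/-- The evaluation at one of the given points. -/
def zeroOneEval (w : W) : Hom (zeroOne ψ) F1 where
  toMonoidHom :=
    { toFun := fun a => Subtype.mk (ψ w (show zeroOneSubmonoid ψ from a).1)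
        ((show zeroOneSubmonoid ψ from a).2 w)
      map_zero' := Subtype.ext (map_zero (ψ w))
      map_one' := Subtype.ext (map_one (ψ w))
      map_mul' := fun a b => Subtype.ext (map_mul (ψ w) _ _) }
  map_isSum n k a b h := by
    let a' : Fin (n + 2) → zeroOneSubmonoid ψ := a
    have h' : ∑ j, k j • (a' j).1 = (show zeroOneSubmonoid ψ from b).1 := h
    change ∑ j, k j • ψ w (a' j).1 = ψ w (show zeroOneSubmonoid ψ from b).1
    rw [← h', map_sum]
    exact Finset.sum_congr rfl fun j _ => (map_zsmul (ψ w) (k j) _).symm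

/-- The local points over `𝔽₁` defined by the given integral points. -/
def pointOf (w : W) : Points (specC (zeroOne ψ)) F1 :=
  ⟨specMap (zeroOneEval w), specMap_isLocal zeroOne_sub_sq _⟩

theorem isMatrixOf_pointOf {ι : Type} [Fintype ι] [DecidableEq ι] (X : Matrix ι ι R) (w : W) :
    IsMatrixOf X (zeroOneSubmonoid ψ) zero_mem_zeroOneSubmonoid (pointOf w) (X.map (ψ w)) :=
  ⟨ψ w, specMap_comp _ _, rfl⟩

/-! ### Elements of the ring separating the points -/

variable [DecidableEq W] {e : W → R}

theorem idem_mem (he : ∀ w w', ψ w (e w') = if w = w' then 1 else 0) (w : W) :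
    e w ∈ zeroOneSubmonoid ψ := fun w' => by
  rw [he]
  split_ifs
  exacts [Or.inr rfl, Or.inl rfl]

theorem univLift_zeroOne_bijective [Fintype W] (he : ∀ w w', ψ w (e w') = if w = w' then 1 else 0) :
    Function.Bijective (univLift (zeroOneIncl (ψ := ψ))) := by
  refine ⟨univLift_incl_injective _ _, RingHom.range_eq_top.mp (eq_top_iff.mpr fun r _ => ?_)⟩
  have hA : ∀ a ∈ zeroOneSubmonoid ψ, a ∈ (univLift (zeroOneIncl (ψ := ψ))).range := fun a ha =>
    ⟨(zeroOne ψ).toUniv (⟨a, ha⟩ : zeroOneSubmonoid ψ), univLift_toUniv _ _⟩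
  -- The first summand vanishes at every point, hence lies in the submonoid; the second is an
  -- integral combination of its elements.
  have hr : r = (r - ∑ w, ψ w r • e w) + ∑ w, ψ w r • e w := (sub_add_cancel _ _).symm
  rw [hr]
  refine add_mem (hA _ fun w => Or.inl ?_) (sum_mem fun w _ => zsmul_mem (hA _ (idem_mem he w)) _)
  rw [map_sub, map_sum]
  simp [he]

/-- Since the universal ring is `R`, the morphism extends to `χ : R →+* ℤ`. This kills everything
vanishing at all points, so `χ` sees the `e w` as idempotents with sum `1` and picks out exactly one
of them. -/
theorem exists_eq_zeroOneEval [Fintype W] (he : ∀ w w', ψ w (e w') = if w = w' then 1 else 0)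
    (φ : Hom (zeroOne ψ) F1) : ∃ w, φ = zeroOneEval w := by
  let E := RingEquiv.ofBijective _ (univLift_zeroOne_bijective he)
  let χ : R →+* ℤ := (univLift (F1.toInt.comp φ)).comp E.symm.toRingHom
  have hχ : ∀ a : zeroOneSubmonoid ψ, χ a.1 = F1.val (φ a) := by
    intro a
    have h1 : E.symm a.1 = (zeroOne ψ).toUniv a := by
      rw [RingEquiv.symm_apply_eq]
      exact (univLift_zeroOneIncl a).symm
    exact (congrArg (univLift (F1.toInt.comp φ)) h1).trans (univLift_toUniv _ _)
  have hχ01 : ∀ r ∈ zeroOneSubmonoid ψ, χ r = 0 ∨ χ r = 1 := fun r hr => by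
    rw [hχ ⟨r, hr⟩]
    exact (φ _).2
  have hker : ∀ r, (∀ w, ψ w r = 0) → χ r = 0 := by
    intro r hr
    have h1 := hχ01 r fun w => Or.inl (hr w)
    -- Doubling is what excludes the value `1`: `r + r` also vanishes at all points, and `2` is not
    -- an allowed value.
    have h2 := hχ01 (r + r) fun w => Or.inl (by rw [map_add, hr w, add_zero])
    rw [map_add] at h2
    omega
  have hsum : ∑ w, χ (e w) = 1 := by
    have h := hker (1 - ∑ w, e w) fun w => by
      rw [map_sub, map_sum, map_one]
      simp [he]
    rw [map_sub, map_one, map_sum] at h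
    linarith
  obtain ⟨w, hw⟩ : ∃ w, χ (e w) = 1 := by
    by_contra! hne
    rw [Finset.sum_eq_zero fun w _ => (hχ01 _ (idem_mem he w)).resolve_right (hne w)] at hsum
    exact zero_ne_one hsum
  have hall : ∀ r, χ r = ψ w r := by
    intro r
    -- Modulo elements vanishing at all points, `e w` projects onto the factor at `w`, where `r`
    -- equals the integer `ψ w r`.
    have h := hker ((r - (ψ w r : ℤ)) * e w) fun w' => by
      rw [map_mul, he]
      split_ifs with h
      · subst h
        simp
      · simp
    rw [map_mul, hw, mul_one, map_sub, map_intCast] at h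
    simpa [sub_eq_zero] using h
  exact ⟨w, Hom.ext_apply fun a => F1.val_injective ((hχ a).symm.trans (hall _))⟩

theorem pointOf_bijective [Fintype W] (he : ∀ w w', ψ w (e w') = if w = w' then 1 else 0) :
    Function.Bijective (pointOf (ψ := ψ)) := by
  refine ⟨fun w w' h => ?_, fun P => ?_⟩
  · have h1 : zeroOneEval w = zeroOneEval w' := specMap_injective (congrArg Subtype.val h)
    have h2 := congrArg (fun φ : Hom (zeroOne ψ) F1 =>
      F1.val (φ (⟨e w, idem_mem he w⟩ : zeroOneSubmonoid ψ))) h1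
    have h3 : ψ w (e w) = ψ w' (e w) := h2
    rw [he, he, if_pos rfl] at h3
    by_contra hne
    rw [if_neg (Ne.symm hne)] at h3
    exact one_ne_zero h3
  · obtain ⟨w, hw⟩ := exists_eq_zeroOneEval he (pointHom P.1)
    exact ⟨w, Subtype.ext ((congrArg specMap hw.symm).trans (specMap_pointHom P.2))⟩

/-- The trivial congruence on the integers. -/
def intPoint : PrimeCongruence (ofRing ℤ) where
  rel := ⊥
  isCongruence := ⟨ofRing ℤ, ⟨MonoidWithZeroHom.id _, fun _ _ _ _ h => h⟩, Function.surjective_id,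
    fun _ _ => Iff.rfl⟩
  not_one_zero h := Int.zero_ne_one (Eq.symm h)
  prime a b f h := by
    have h' : (show ℤ from a) * (show ℤ from f) = (show ℤ from b) * (show ℤ from f) := h
    rcases mul_eq_mul_right_iff.mp h' with h1 | h1
    exacts [Or.inl h1, Or.inr h1]

/-- Pulling back the trivial congruence on `ℤ` shows that `ψ w` and `χ` have the same kernel
relation on the submonoid. As `ψ w` only takes the values `0` and `1` there, comparison with the
elements `0` and `1` yields equality, and the submonoid generates the ring. -/
theorem eq_of_isMatrixOf_pointOf [Fintype W] {ι : Type} [Fintype ι] [DecidableEq ι] {X : Matrix ι ι R} {w : W}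
    (he : ∀ w w', ψ w (e w') = if w = w' then 1 else 0) {g : Matrix ι ι ℤ}
    (h : IsMatrixOf X (zeroOneSubmonoid ψ) zero_mem_zeroOneSubmonoid (pointOf w) g) :
    g = X.map (ψ w) := by
  obtain ⟨χ, hχ, rfl⟩ := h
  have h1 : specMap (F1.toInt.comp (zeroOneEval w)) = specMap ((ofRingHom χ).comp zeroOneIncl) :=
    (specMap_comp _ _).symm.trans hχ
  have h2 : ∀ a b : zeroOneSubmonoid ψ, ψ w a = ψ w b ↔ χ a = χ b :=
    specMap_injective_of_base intPoint h1
  have h3 : ∀ a : zeroOneSubmonoid ψ, ψ w a = χ a := by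
    intro a
    have e0 := h2 a ⟨0, zero_mem_zeroOneSubmonoid⟩
    have e1 := h2 a 1
    simp only [map_zero, OneMemClass.coe_one, map_one] at e0 e1
    rcases a.2 w with h | h
    · rw [h, e0.mp h]
    · rw [h, e1.mp h]
  have h4 : (ψ w).comp (univLift zeroOneIncl) = χ.comp (univLift (zeroOneIncl (ψ := ψ))) :=
    univRing_hom_ext fun a => by
      rw [RingHom.comp_apply, RingHom.comp_apply, univLift_toUniv]
      exact h3 a
  have h5 : ψ w = χ := (RingHom.cancel_right (univLift_zeroOne_bijective he).2).mp h4
  rw [h5]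

theorem isTitsModel_zeroOne [Fintype W] {ι : Type} [Fintype ι] [DecidableEq ι] {X : Matrix ι ι R}
    {N T : Subgroup (GL ι ℤ)} (he : ∀ w w', ψ w (e w') = if w = w' then 1 else 0)
    (s : W → N) (hs : ∀ w, X.map (ψ w) = ((s w : GL ι ℤ) : Matrix ι ι ℤ))
    (hbij : Function.Bijective fun w => (QuotientGroup.mk (s w) : N ⧸ T.subgroupOf N)) :
    IsTitsModel X (zeroOneSubmonoid ψ) zero_mem_zeroOneSubmonoid N T := by
  let E := Equiv.ofBijective _ (pointOf_bijective he)
  refine ⟨univLift_zeroOne_bijective he, ⟨fun φ _ => specMap_isLocal zeroOne_sub_sq φ,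
    specMap_injective.injOn, fun P hP => ⟨pointHom P, trivial, specMap_pointHom hP⟩⟩,
    fun P => s (E.symm P), fun P => ?_, ?_⟩
  · obtain ⟨w, rfl⟩ := E.surjective P
    have h : E.symm (E w) = w := E.symm_apply_apply w
    change IsMatrixOf X _ _ (pointOf w) ((s (E.symm (E w)) : GL ι ℤ) : Matrix ι ι ℤ)
    rw [h, ← hs]
    exact isMatrixOf_pointOf X w
  · exact hbij.comp E.symm.bijective

theorem exists_isMatrixOf_iff [Fintype W] {ι : Type} [Fintype ι] [DecidableEq ι] {X : Matrix ι ι R}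
    (he : ∀ w w', ψ w (e w') = if w = w' then 1 else 0) (g : Matrix ι ι ℤ) :
    (∃ P, IsMatrixOf X (zeroOneSubmonoid ψ) zero_mem_zeroOneSubmonoid P g) ↔
      ∃ w, g = X.map (ψ w) := by
  constructor
  · rintro ⟨P, hP⟩
    obtain ⟨w, rfl⟩ := (pointOf_bijective he).2 P
    exact ⟨w, eq_of_isMatrixOf_pointOf he hP⟩
  · rintro ⟨w, rfl⟩
    exact ⟨pointOf w, isMatrixOf_pointOf X w⟩

end

end Sesquiad

open Sesquiad

noncomputable section

variable {ι : Type} [Fintype ι]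

/-! ### Monomial matrices -/

/-- Each row has at most one nonzero entry. -/
def Matrix.RowMonomial {S : Type} [MulZeroClass S] (g : Matrix ι ι S) : Prop :=
  ∀ i j k, j ≠ k → g i j * g i k = 0

theorem Matrix.RowMonomial.mul_apply {g : Matrix ι ι ℤ} (hg : g.RowMonomial) {i j : ι}
    (hij : g i j ≠ 0) (a : Matrix ι ι ℤ) (k : ι) : (g * a) i k = g i j * a j k := by
  rw [Matrix.mul_apply]
  refine Finset.sum_eq_single j (fun l _ hl => ?_) fun h => absurd (Finset.mem_univ j) h
  rw [(mul_eq_zero.mp (hg i j l hl.symm)).resolve_left hij, zero_mul]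

variable [DecidableEq ι] {g h : GL ι ℤ}

theorem GL.mul_inv_apply (g : GL ι ℤ) (i j : ι) :
    ((g : Matrix ι ι ℤ) * ((g⁻¹ : GL ι ℤ) : Matrix ι ι ℤ)) i j = if i = j then 1 else 0 := by
  rw [← Units.val_mul, mul_inv_cancel, Units.val_one, Matrix.one_apply]

theorem GL.exists_ne_zero (g : GL ι ℤ) (i : ι) : ∃ j, g i j ≠ 0 := by
  by_contra! h
  have e := GL.mul_inv_apply g i i
  rw [if_pos rfl, Matrix.mul_apply, Finset.sum_eq_zero fun j _ => by rw [h j, zero_mul]] at e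
  exact zero_ne_one e

theorem GL.entry_mul_inv (hg : (g : Matrix ι ι ℤ).RowMonomial) {i j : ι} (hij : g i j ≠ 0)
    (k : ι) : g i j * (g⁻¹ : GL ι ℤ) j k = if i = k then 1 else 0 := by
  rw [← GL.mul_inv_apply g, hg.mul_apply hij]

theorem GL.sq_eq_one (hg : (g : Matrix ι ι ℤ).RowMonomial) {i j : ι} (hij : g i j ≠ 0) :
    g i j ^ 2 = 1 := by
  have e := GL.entry_mul_inv hg hij i
  rw [if_pos rfl] at e
  exact Int.isUnit_sq (IsUnit.of_mul_eq_one _ e)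

/-- A monomial matrix is supported on the graph of a permutation. -/
theorem GL.exists_perm (hg : (g : Matrix ι ι ℤ).RowMonomial) :
    ∃ σ : Equiv.Perm ι, ∀ i j, g i j ≠ 0 ↔ σ i = j := by
  choose f hf using GL.exists_ne_zero g
  have hinj : Function.Injective f := by
    intro i k hik
    -- Two rows supported in the same column would force the same entry of `g⁻¹` to be both zero and
    -- invertible.
    by_contra hne
    have e := GL.entry_mul_inv hg (hf i) i
    have e' := GL.entry_mul_inv hg (hf k) i
    rw [if_neg (Ne.symm hne), ← hik] at e'
    rw [(mul_eq_zero.mp e').resolve_left (hik ▸ hf k), mul_zero, if_pos rfl] at e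
    exact zero_ne_one e
  refine ⟨Equiv.ofBijective f (Finite.injective_iff_bijective.mp hinj), fun i j => ?_⟩
  change _ ↔ f i = j
  refine ⟨fun hij => ?_, fun h => h ▸ hf i⟩
  by_contra hne
  exact (mul_ne_zero (hf i) hij) (hg i _ _ hne)

theorem diagHom_apply {S : Type} [CommRing S] (t : ι → Sˣ) :
    ((diagHom ι S t : GL ι S) : Matrix ι ι S) = Matrix.diagonal fun i => (t i : S) := rfl

theorem GL.exists_diagHom (h : ∀ i j, i ≠ j → g i j = 0) : ∃ t, g = diagHom ι ℤ t := by
  have hg : (g : Matrix ι ι ℤ).RowMonomial := fun i j k hjk => by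
    by_cases hij : i = j
    · rw [h i k (hij ▸ hjk), mul_zero]
    · rw [h i j hij, zero_mul]
  have hne : ∀ i, g i i ≠ 0 := fun i hi => by
    obtain ⟨j, hj⟩ := GL.exists_ne_zero g i
    by_cases hij : i = j
    · exact hj (hij ▸ hi)
    · exact hj (h i j hij)
  have hu : ∀ i, IsUnit (g i i) := fun i => by
    have e := GL.entry_mul_inv hg (hne i) i
    rw [if_pos rfl] at e
    exact IsUnit.of_mul_eq_one _ e
  refine ⟨fun i => (hu i).unit, Units.ext (Matrix.ext fun i j => ?_)⟩
  rw [diagHom_apply, Matrix.diagonal_apply]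
  split_ifs with hij
  · subst hij
    rfl
  · exact h i j hij

theorem GL.mul_inv_diagonal (hg : (g : Matrix ι ι ℤ).RowMonomial)
    (hh : (h : Matrix ι ι ℤ).RowMonomial) (hs : ∀ i j, g i j = 0 ↔ h i j = 0) :
    ∃ t, h * g⁻¹ = diagHom ι ℤ t := by
  refine GL.exists_diagHom fun i k hik => ?_
  obtain ⟨j, hj⟩ := GL.exists_ne_zero g i
  have e := GL.entry_mul_inv hg hj k
  rw [if_neg hik] at e
  rw [Units.val_mul, hh.mul_apply (fun h0 => hj ((hs i j).mpr h0)),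
    (mul_eq_zero.mp e).resolve_left hj, mul_zero]

/-! ### Normalizers of tori -/

section Normalizer

variable {G : Subgroup (GL ι ℤ)} {T : ∀ (S : Type) [CommRing S], Subgroup (GL ι S)}

/-- Conjugating a diagonal matrix `t` by `g` gives a diagonal matrix `s`, so `g i j * t j = s i * g
i j`. Distinct entries of `t` allow at most one nonzero `g i j` in row `i`. Rational points are used
because the units `±1` of `ℤ` are too few for a regular element. -/
theorem rowMonomial_of_mem_normalizerPts (hT : T ℚ ≤ (diagHom ι ℚ).range)
    (hreg : ∃ t : ι → ℚˣ, Function.Injective t ∧ diagHom ι ℚ t ∈ T ℚ)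
    (hg : g ∈ normalizerPts G T) : (g : Matrix ι ι ℤ).RowMonomial := by
  obtain ⟨t, ht, htT⟩ := hreg
  have h1 := (Subgroup.mem_normalizer_iff.mp (hg.2 ℚ) _).mp htT
  obtain ⟨s, hs⟩ := hT h1
  have h2 : Matrix.GeneralLinearGroup.map (Int.castRingHom ℚ) g * diagHom ι ℚ t =
      diagHom ι ℚ s * Matrix.GeneralLinearGroup.map (Int.castRingHom ℚ) g := by
    rw [hs, inv_mul_cancel_right]
  have h3 : ∀ i j, (g i j : ℚ) * t j = s i * g i j := fun i j => by
    have h4 := congrArg (fun a : GL ι ℚ => (a : Matrix ι ι ℚ) i j) h2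
    simp only [Units.val_mul, diagHom_apply] at h4
    rw [Matrix.mul_diagonal,
      Matrix.diagonal_mul] at h4
    exact h4
  intro i j k hjk
  by_contra hne
  have hj : (g i j : ℚ) ≠ 0 := Int.cast_ne_zero.mpr (left_ne_zero_of_mul hne)
  have hk : (g i k : ℚ) ≠ 0 := Int.cast_ne_zero.mpr (right_ne_zero_of_mul hne)
  have ej : (t j : ℚ) = s i := mul_left_cancel₀ hj ((h3 i j).trans (mul_comm _ _))
  have ek : (t k : ℚ) = s i := mul_left_cancel₀ hk ((h3 i k).trans (mul_comm _ _))
  exact hjk (ht (Units.ext (ej.trans ek.symm)))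

/-- With equal supports `h * g⁻¹` is diagonal and lies in `G`, hence in the torus; conjugation by
`g`, which normalizes the torus, turns it into `g⁻¹ * h`. -/
theorem inv_mul_mem_of_support (hdiag : ∀ t, diagHom ι ℤ t ∈ G → diagHom ι ℤ t ∈ T ℤ)
    (hg : g ∈ normalizerPts G T) (hh : h ∈ normalizerPts G T)
    (hgm : (g : Matrix ι ι ℤ).RowMonomial) (hhm : (h : Matrix ι ι ℤ).RowMonomial)
    (hs : ∀ i j, g i j = 0 ↔ h i j = 0) : g⁻¹ * h ∈ T ℤ := by
  obtain ⟨t, ht⟩ := GL.mul_inv_diagonal hgm hhm hs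
  have h1 : h * g⁻¹ ∈ T ℤ := ht ▸ hdiag t (ht ▸ mul_mem hh.1 (inv_mem hg.1))
  have h2 := hg.2 ℤ
  have h3 : Matrix.GeneralLinearGroup.map (Int.castRingHom ℤ) g = g :=
    Units.ext (Matrix.ext fun i j => rfl)
  rw [h3] at h2
  have h4 := (Subgroup.mem_normalizer_iff''.mp h2 _).mp h1
  rwa [mul_assoc, inv_mul_cancel_right] at h4

/-- A set of representatives in the normalizer of a torus defines a Tits model. -/
theorem exists_isTitsModel {R : Type} [CommRing R] {X : Matrix ι ι R}
    (hpt : ∀ g ∈ G, ∃ ψ : R →+* ℤ, X.map ψ = (g : Matrix ι ι ℤ))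
    (hT : T ℚ ≤ (diagHom ι ℚ).range)
    (hreg : ∃ t : ι → ℚˣ, Function.Injective t ∧ diagHom ι ℚ t ∈ T ℚ)
    (hdiag : ∀ t, diagHom ι ℤ t ∈ G → diagHom ι ℤ t ∈ T ℤ)
    {W : Type} [Finite W] (s : W → normalizerPts G T)
    (hs : Function.Bijective fun w =>
      (QuotientGroup.mk (s w) : normalizerPts G T ⧸ (T ℤ).subgroupOf (normalizerPts G T))) :
    ∃ (A : Submonoid R) (h0 : (0 : R) ∈ A), IsTitsModel X A h0 (normalizerPts G T) (T ℤ) ∧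
      ∀ g, (∃ P, IsMatrixOf X A h0 P g) ↔ ∃ w, g = ((s w : GL ι ℤ) : Matrix ι ι ℤ) := by
  classical
  have := Fintype.ofFinite W
  choose ψ hψ using fun w => hpt _ (s w).2.1
  have hmon : ∀ w, ((s w : GL ι ℤ) : Matrix ι ι ℤ).RowMonomial := fun w =>
    rowMonomial_of_mem_normalizerPts hT hreg (s w).2
  have hentry : ∀ w i j, ψ w (X i j) = (s w : GL ι ℤ) i j := fun w i j =>
    congrFun (congrFun (hψ w) i) j
  -- Squares of entries of a monomial matrix are `0` or `1`, so this product equals `1` exactly when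
  -- the support is that of `s w'`. Signs are invisible, and need not be seen, because the support
  -- already determines the class modulo the torus.
  have he : ∀ w w', ψ w (∏ i, ∏ j, if (s w' : GL ι ℤ) i j = 0 then 1 - X i j ^ 2 else X i j ^ 2) =
      if w = w' then 1 else 0 := by
    intro w w'
    rw [map_prod]
    simp only [map_prod, apply_ite (ψ w), map_sub, map_one, map_pow, hentry]
    split_ifs with hw
    · subst hw
      refine Finset.prod_eq_one fun i _ => Finset.prod_eq_one fun j _ => ?_
      split_ifs with h0
      · rw [h0]
        rfl
      · exact GL.sq_eq_one (hmon w) h0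
    · by_contra hne
      refine hw (hs.1 (QuotientGroup.eq.mpr ?_))
      refine inv_mul_mem_of_support hdiag (s w).2 (s w').2 (hmon w) (hmon w') fun i j => ?_
      have hij := Finset.prod_ne_zero_iff.mp (Finset.prod_ne_zero_iff.mp hne i (Finset.mem_univ i))
        j (Finset.mem_univ j)
      split_ifs at hij with h0
      · refine iff_of_true ?_ h0
        by_contra h1
        rw [GL.sq_eq_one (hmon w) h1] at hij
        exact hij rfl
      · exact iff_of_false (fun h1 => hij (by rw [h1]; rfl)) h0
  refine ⟨_, _, isTitsModel_zeroOne he s hψ hs, fun g => ?_⟩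
  rw [exists_isMatrixOf_iff he]
  simp only [hψ]

theorem exists_isTitsModel_of_points {R : Type} [CommRing R] {X : Matrix ι ι R}
    (hpt : ∀ g ∈ G, ∃ ψ : R →+* ℤ, X.map ψ = (g : Matrix ι ι ℤ))
    (hT : T ℚ ≤ (diagHom ι ℚ).range)
    (hreg : ∃ t : ι → ℚˣ, Function.Injective t ∧ diagHom ι ℚ t ∈ T ℚ)
    (hdiag : ∀ t, diagHom ι ℤ t ∈ G → diagHom ι ℤ t ∈ T ℤ) :
    ∃ (A : Submonoid R) (h0 : (0 : R) ∈ A), IsTitsModel X A h0 (normalizerPts G T) (T ℤ) := by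
  let Q := normalizerPts G T ⧸ (T ℤ).subgroupOf (normalizerPts G T)
  have hmon : ∀ q : Q, ((q.out : GL ι ℤ) : Matrix ι ι ℤ).RowMonomial := fun q =>
    rowMonomial_of_mem_normalizerPts hT hreg q.out.2
  have hfin : Finite Q := by
    -- There are finitely many support patterns, and each belongs to at most one class modulo the
    -- torus.
    refine Finite.of_injective (β := ι → ι → Prop) (fun q i j => (q.out : GL ι ℤ) i j = 0) ?_
    intro p q hpq
    rw [← p.out_eq', ← q.out_eq']
    exact QuotientGroup.eq.mpr (inv_mul_mem_of_support hdiag p.out.2 q.out.2 (hmon p) (hmon q)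
      fun i j => iff_of_eq (congrFun (congrFun hpq i) j))
  obtain ⟨A, h0, h, -⟩ := exists_isTitsModel hpt hT hreg hdiag (W := Q) (fun q => q.out) (by
    simp only [QuotientGroup.out_eq']
    exact Function.bijective_id)
  exact ⟨A, h0, h⟩

end Normalizer

/-! ### Integral points of the matrix groups -/

theorem exists_GLRing_hom (g : GL ι ℤ) :
    ∃ ψ : GLRing ι →+* ℤ, (GLUniv ι).map ψ = (g : Matrix ι ι ℤ) := by
  let f : MvPolynomial ((ι × ι) ⊕ Unit) ℤ →+* ℤ := MvPolynomial.eval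
    (Sum.elim (fun p => g p.1 p.2) fun _ => ((g⁻¹ : GL ι ℤ) : Matrix ι ι ℤ).det)
  refine ⟨Ideal.Quotient.lift _ f fun a ha => ?_, ?_⟩
  · refine (Ideal.span_le.mpr ?_ : _ ≤ RingHom.ker f) ha
    rintro _ rfl
    rw [SetLike.mem_coe, RingHom.mem_ker, map_sub, map_mul, RingHom.map_det, map_one]
    have h1 : f.mapMatrix (Matrix.of fun i j => (MvPolynomial.X (Sum.inl (i, j)) :
        MvPolynomial ((ι × ι) ⊕ Unit) ℤ)) = (g : Matrix ι ι ℤ) :=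
      Matrix.ext fun i j => MvPolynomial.eval_X _
    have h2 : f (MvPolynomial.X (Sum.inr ())) = ((g⁻¹ : GL ι ℤ) : Matrix ι ι ℤ).det :=
      MvPolynomial.eval_X _
    rw [h1, h2, ← Matrix.det_mul, ← Units.val_mul, mul_inv_cancel, Units.val_one, Matrix.det_one,
      sub_self]
  · refine Matrix.ext fun i j => ?_
    change f (MvPolynomial.X (Sum.inl (i, j))) = g i j
    exact MvPolynomial.eval_X _

theorem exists_FormRing_hom (J : Matrix ι ι ℤ) (hg : g ∈ formGroup J) :
    ∃ ψ : FormRing J →+* ℤ, (FormUniv J).map ψ = (g : Matrix ι ι ℤ) := by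
  let f : MvPolynomial (ι × ι) ℤ →+* ℤ := MvPolynomial.eval fun p => g p.1 p.2
  have h1 : f.mapMatrix (Matrix.mvPolynomialX ι ι ℤ) = (g : Matrix ι ι ℤ) :=
    Matrix.ext fun i j => MvPolynomial.eval_X _
  have h2 : f.mapMatrix (J.map (Int.castRingHom (MvPolynomial (ι × ι) ℤ))) = J :=
    Matrix.ext fun i j => map_intCast f _
  refine ⟨Ideal.Quotient.lift _ f fun a ha => ?_, ?_⟩
  · refine (Ideal.span_le.mpr ?_ : _ ≤ RingHom.ker f) ha
    rintro _ ⟨i, j, rfl⟩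
    have h3 : f.mapMatrix (formRel J) = 0 := by
      have h4 : f.mapMatrix (Matrix.mvPolynomialX ι ι ℤ).transpose =
          (g : Matrix ι ι ℤ).transpose := by
        rw [← h1]
        rfl
      rw [formRel, map_sub, map_mul, map_mul, h1, h2, h4, sub_eq_zero]
      exact hg
    exact congrFun (congrFun h3 i) j
  · exact Matrix.ext fun i j => congrFun (congrFun h1 i) j

/-! ### Regular elements of the tori -/

/-- The powers of two as rational units. -/
def ratPow (z : ℤ) : ℚˣ := Units.mk0 (2 : ℚ) two_ne_zero ^ z

theorem ratPow_injective : Function.Injective ratPow := fun a b h => by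
  have h' := congrArg Units.val h
  simp only [ratPow, Units.val_zpow_eq_zpow_val, Units.val_mk0] at h'
  exact zpow_right_injective₀ two_pos (by norm_num) h'

theorem torusGL_regular (n : ℕ) :
    ∃ t : Fin n → ℚˣ, Function.Injective t ∧ diagHom _ ℚ t ∈ torusGL n ℚ :=
  ⟨fun i => ratPow i, fun i j h => Fin.ext (by exact_mod_cast ratPow_injective h), _, rfl⟩

theorem torusSp_regular (n : ℕ) :
    ∃ t : Fin n ⊕ Fin n → ℚˣ, Function.Injective t ∧ diagHom _ ℚ t ∈ torusSp n ℚ := by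
  -- The shift to `i + 1` keeps the exponents positive, so that none coincides with the negative of
  -- another.
  refine ⟨Sum.elim (fun i => ratPow (i + 1)) (fun i => ratPow (i + 1))⁻¹, ?_, _, rfl⟩
  have h : ∀ i : Fin n, (ratPow (i + 1))⁻¹ = ratPow (-(i + 1)) := fun i => (zpow_neg _ _).symm
  rintro (i | i) (j | j) hij <;>
    simp only [Sum.elim_inl, Sum.elim_inr, Pi.inv_apply, h] at hij <;>
    have hij' := ratPow_injective hij
  · exact congrArg _ (Fin.ext (by omega))
  · omega
  · omega
  · exact congrArg _ (Fin.ext (by omega))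

theorem torusO_regular (n : ℕ) :
    ∃ t : OIdx n → ℚˣ, Function.Injective t ∧ diagHom _ ℚ t ∈ torusO n ℚ := by
  -- The exponents `±(m + 1)` are nonzero, so they also avoid the last entry `1 = 2 ^ 0` present for
  -- odd `n`.
  refine ⟨Sum.elim (fun p => if p.1 = 0 then ratPow (p.2 + 1) else (ratPow (p.2 + 1))⁻¹) 1, ?_,
    fun m => ratPow (m + 1), rfl⟩
  have h : ∀ i : Fin (n / 2), (ratPow (i + 1))⁻¹ = ratPow (-(i + 1)) :=
    fun i => (zpow_neg _ _).symm
  have h1 : (1 : ℚˣ) = ratPow 0 := (zpow_zero _).symm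
  rintro (⟨a, i⟩ | i) (⟨b, j⟩ | j) hij
  · fin_cases a <;> fin_cases b <;> simp [h] at hij <;> have hij' := ratPow_injective hij
    · rw [show i = j from Fin.ext (by omega)]
    · omega
    · omega
    · rw [show i = j from Fin.ext (by omega)]
  · fin_cases a <;> simp [h, -inv_eq_one] at hij <;> rw [h1] at hij <;>
      have hij' := ratPow_injective hij <;> omega
  · fin_cases b <;> simp [h, -inv_eq_one] at hij <;> rw [h1] at hij <;>
      have hij' := ratPow_injective hij <;> omega
  · exact congrArg _ (Fin.ext (by omega))

theorem torusSp_le (n : ℕ) : torusSp n ℚ ≤ (diagHom _ ℚ).range := by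
  rintro _ ⟨t, rfl⟩
  exact ⟨_, rfl⟩

theorem torusO_le (n : ℕ) : torusO n ℚ ≤ (diagHom _ ℚ).range := by
  rintro _ ⟨t, rfl⟩
  exact ⟨_, rfl⟩

theorem diag_mem_formGroup {J : Matrix ι ι ℤ} {t : ι → ℤˣ} (h : diagHom ι ℤ t ∈ formGroup J)
    (i j : ι) : (t i : ℤ) * J i j * t j = J i j := by
  have h1 : ((diagHom ι ℤ t : GL ι ℤ) : Matrix ι ι ℤ) * J *
    ((diagHom ι ℤ t : GL ι ℤ) : Matrix ι ι ℤ).transpose = J := h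
  rw [diagHom_apply, Matrix.diagonal_transpose] at h1
  have h2 := congrFun (congrFun h1 i) j
  rwa [Matrix.mul_diagonal, Matrix.diagonal_mul] at h2

theorem diag_mem_torusSp (n : ℕ) (t : Fin n ⊕ Fin n → ℤˣ)
    (h : diagHom _ ℤ t ∈ formGroup (Matrix.J (Fin n) ℤ)) : diagHom _ ℤ t ∈ torusSp n ℤ := by
  refine ⟨fun i => t (Sum.inl i), congrArg _ (funext ?_)⟩
  rintro (i | i)
  · rfl
  · have e := diag_mem_formGroup h (Sum.inl i) (Sum.inr i)
    simp [Matrix.J] at e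
    refine eq_inv_of_mul_eq_one_right (Units.ext ?_)
    simpa using e

theorem diag_pair_eq_one {n : ℕ} {t : OIdx n → ℤˣ} (h : diagHom _ ℤ t ∈ formGroup (splitForm n))
    (m : Fin (n / 2)) : t (Sum.inl (0, m)) * t (Sum.inl (1, m)) = 1 := by
  have e := diag_mem_formGroup h (Sum.inl (0, m)) (Sum.inl (1, m))
  simp [splitForm, Matrix.blockDiagonal_apply] at e
  exact Units.ext (by simpa using e)

theorem diag_mem_torusO {n : ℕ} (t : OIdx n → ℤˣ) (h : diagHom _ ℤ t ∈ formGroup (splitForm n))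
    (h1 : ∀ k, t (Sum.inr k) = 1) : diagHom _ ℤ t ∈ torusO n ℤ := by
  refine ⟨fun m => t (Sum.inl (0, m)), congrArg _ (funext ?_)⟩
  rintro (⟨a, m⟩ | k)
  · fin_cases a
    · rfl
    · exact eq_inv_of_mul_eq_one_right (diag_pair_eq_one h m)
  · exact h1 k

/-- Each hyperbolic pair contributes determinant `1`, so the remaining entry, if there is one,
equals the total determinant. This excludes the sign `-1`, which the form alone would allow for odd
`n`. -/
theorem diag_mem_torusO_of_det {n : ℕ} (t : OIdx n → ℤˣ)
    (h : diagHom _ ℤ t ∈ formGroup (splitForm n) ⊓ detOne (OIdx n)) :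
    diagHom _ ℤ t ∈ torusO n ℤ := by
  refine diag_mem_torusO t h.1 fun k => ?_
  have h1 : Matrix.GeneralLinearGroup.det (diagHom _ ℤ t) = 1 := h.2
  have h2 : ∏ i, t i = 1 := by
    rw [← h1]
    refine Units.ext ?_
    rw [Units.coe_prod]
    exact (Matrix.det_diagonal).symm
  rw [Fintype.prod_sum_type, Fintype.prod_prod_type_right] at h2
  have h3 : ∀ m : Fin (n / 2), ∏ a, t (Sum.inl (a, m)) = 1 := fun m => by
    rw [Fin.prod_univ_two, diag_pair_eq_one h.1]
  have hsub : Subsingleton (Fin (n % 2)) := by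
    rcases Nat.mod_two_eq_zero_or_one n with h | h <;> rw [h] <;> infer_instance
  rw [Finset.prod_congr rfl fun m _ => h3 m, Finset.prod_const_one, one_mul,
    Fintype.prod_subsingleton _ k] at h2
  exact h2

/-! ### Permutation matrices -/

/-- A permutation matrix as an invertible matrix. -/
def permGL {n : ℕ} (S : Type) [CommRing S] (σ : Equiv.Perm (Fin n)) : GL (Fin n) S where
  val := σ.permMatrix S
  inv := σ⁻¹.permMatrix S
  val_inv := by rw [← Matrix.permMatrix_mul, inv_mul_cancel, Matrix.permMatrix_one]
  inv_val := by rw [← Matrix.permMatrix_mul, mul_inv_cancel, Matrix.permMatrix_one]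

theorem permGL_apply {n : ℕ} {S : Type} [CommRing S] (σ : Equiv.Perm (Fin n)) (i j : Fin n) :
    permGL S σ i j = if σ i = j then 1 else 0 := by
  change σ.permMatrix S i j = _
  simp [Equiv.Perm.permMatrix, PEquiv.toMatrix_apply, eq_comm]

theorem permGL_conj {n : ℕ} {S : Type} [CommRing S] (σ : Equiv.Perm (Fin n)) (t : Fin n → Sˣ) :
    permGL S σ * diagHom _ S t = diagHom _ S (t ∘ σ) * permGL S σ := by
  refine Units.ext (Matrix.ext fun i j => ?_)
  rw [Units.val_mul, Units.val_mul, diagHom_apply, diagHom_apply, Matrix.mul_diagonal,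
    Matrix.diagonal_mul, permGL_apply]
  split_ifs with h
  · rw [← h, one_mul, mul_one]
    rfl
  · rw [zero_mul, mul_zero]

theorem permGL_mem {n : ℕ} (σ : Equiv.Perm (Fin n)) :
    permGL ℤ σ ∈ normalizerPts ⊤ (torusGL n) := by
  refine ⟨trivial, fun S _ => Subgroup.mem_normalizer_iff.mpr fun h => ?_⟩
  have e : Matrix.GeneralLinearGroup.map (Int.castRingHom S) (permGL ℤ σ) = permGL S σ := by
    refine Units.ext (Matrix.ext fun i j => ?_)
    refine (congrArg (Int.castRingHom S) (permGL_apply σ i j)).trans ?_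
    rw [permGL_apply, apply_ite (Int.castRingHom S), map_one, map_zero]
  rw [e]
  constructor
  · rintro ⟨t, rfl⟩
    exact ⟨t ∘ σ, by rw [permGL_conj, mul_inv_cancel_right]⟩
  · rintro ⟨t, ht⟩
    refine ⟨t ∘ σ.symm, mul_left_cancel (a := permGL S σ) ?_⟩
    rw [permGL_conj, Function.comp_assoc, Equiv.symm_comp_self, Function.comp_id, ht,
      inv_mul_cancel_right]

/-- A diagonal matrix does not change supports, so distinct permutations give distinct classes.
Every element of the normalizer is monomial and shares its support with a permutation matrix, hence
also its class. -/
theorem permGL_bijective (n : ℕ) : Function.Bijective fun σ : Equiv.Perm (Fin n) =>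
    (QuotientGroup.mk (⟨permGL ℤ σ, permGL_mem σ⟩ : normalizerPts ⊤ (torusGL n)) :
      normalizerPts ⊤ (torusGL n) ⧸ (torusGL n ℤ).subgroupOf (normalizerPts ⊤ (torusGL n))) := by
  have hmon : ∀ g ∈ normalizerPts ⊤ (torusGL n), (g : Matrix (Fin n) (Fin n) ℤ).RowMonomial :=
    fun g hg => rowMonomial_of_mem_normalizerPts le_rfl (torusGL_regular n) hg
  constructor
  · intro σ τ h
    have h' : (⟨permGL ℤ σ, permGL_mem σ⟩ : normalizerPts ⊤ (torusGL n))⁻¹ *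
        ⟨permGL ℤ τ, permGL_mem τ⟩ ∈ (torusGL n ℤ).subgroupOf _ := QuotientGroup.eq.mp h
    obtain ⟨t, ht⟩ : (permGL ℤ σ)⁻¹ * permGL ℤ τ ∈ torusGL n ℤ := h'
    have e : permGL ℤ τ = permGL ℤ σ * diagHom _ ℤ t := by rw [ht, mul_inv_cancel_left]
    refine Equiv.ext fun i => ?_
    have e1 : permGL ℤ τ i (τ i) = permGL ℤ σ i (τ i) * t (τ i) := by
      conv_lhs => rw [e]
      rw [Units.val_mul, diagHom_apply, Matrix.mul_diagonal]
    rw [permGL_apply, permGL_apply, if_pos rfl] at e1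
    by_contra hne
    rw [if_neg hne, zero_mul] at e1
    exact one_ne_zero e1
  · intro q
    obtain ⟨g, rfl⟩ := QuotientGroup.mk_surjective q
    obtain ⟨σ, hσ⟩ := GL.exists_perm (hmon _ g.2)
    refine ⟨σ, QuotientGroup.eq.mpr (inv_mul_mem_of_support (T := torusGL n)
      (fun t _ => ⟨t, rfl⟩) (permGL_mem σ)
      g.2 (hmon _ (permGL_mem σ)) (hmon _ g.2) fun i j => ?_)⟩
    rw [← not_iff_not, ← ne_eq, ← ne_eq, hσ, permGL_apply]
    simp

/-! ### Application to the three families of groups -/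

theorem mainTheorem10 (n : ℕ) :
    (∃ (A : Submonoid (GLRing (Fin n))) (h0 : (0 : GLRing (Fin n)) ∈ A),
      IsTitsModel (GLUniv (Fin n)) A h0 (normalizerPts ⊤ (torusGL n)) (torusGL n ℤ) ∧
      ∀ g : Matrix (Fin n) (Fin n) ℤ,
        (∃ P, IsMatrixOf (GLUniv (Fin n)) A h0 P g) ↔
          ∃ σ : Equiv.Perm (Fin n), g = σ.permMatrix ℤ) ∧
    (∃ (A : Submonoid (FormRing (Matrix.J (Fin n) ℤ)))
      (h0 : (0 : FormRing (Matrix.J (Fin n) ℤ)) ∈ A),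
      IsTitsModel (FormUniv (Matrix.J (Fin n) ℤ)) A h0
        (normalizerPts (formGroup (Matrix.J (Fin n) ℤ)) (torusSp n)) (torusSp n ℤ)) ∧
    (∃ (A : Submonoid (FormRing (splitForm n))) (h0 : (0 : FormRing (splitForm n)) ∈ A),
      IsTitsModel (FormUniv (splitForm n)) A h0
        (normalizerPts (formGroup (splitForm n) ⊓ detOne (OIdx n)) (torusO n)) (torusO n ℤ)) ∧
    (Even n →
      ∃ (A : Submonoid (FormRing (splitForm n))) (h0 : (0 : FormRing (splitForm n)) ∈ A),
      IsTitsModel (FormUniv (splitForm n)) A h0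
        (normalizerPts (formGroup (splitForm n)) (torusO n)) (torusO n ℤ)) := by
  refine ⟨?_, ?_, ?_, fun hn => ?_⟩
  · exact exists_isTitsModel (fun g _ => exists_GLRing_hom g) le_rfl (torusGL_regular n)
      (fun t _ => ⟨t, rfl⟩) (fun σ => ⟨permGL ℤ σ, permGL_mem σ⟩) (permGL_bijective n)
  · exact exists_isTitsModel_of_points (fun _ => exists_FormRing_hom _) (torusSp_le n)
      (torusSp_regular n) (diag_mem_torusSp n)
  · exact exists_isTitsModel_of_points (fun _ h => exists_FormRing_hom _ h.1) (torusO_le n)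
      (torusO_regular n) diag_mem_torusO_of_det
  · refine exists_isTitsModel_of_points (fun _ => exists_FormRing_hom _) (torusO_le n)
      (torusO_regular n) fun t h => diag_mem_torusO t h fun k => ?_
    -- For even `n` there is no basis vector outside the hyperbolic planes, so no determinant
    -- condition is needed.
    exact absurd (k.2.trans_eq (Nat.even_iff.mp hn)) (Nat.not_lt_zero _)

end
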